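/- **Setting.** Let $H$ be a separable real Hilbert space, $T>0$, $Q\in\mathcal L(H)$ selfadjoint and positive semidefinite, and $H_0=Q^{1/2}(H)$ with $\langle u,v\rangle_{H_0}=\langle Q^{-1/2}u,Q^{-1/2}v\rangle$ ($Q^{-1/2}$ the pseudo-inverse). Let $\mathcal L_2^0=\mathcal L_2(H_0,H)$ be the space of Hilbert–Schmidt operators, and let $W\in\mathcal C([0,T],\mathcal L(H_0,L^2(\Omega)))$ be a cylindrical $Q$-Wiener process on a probability space $(\Omega,\mathcal F,\mathbf P)$: each $t\mapsto W(t)u$ is a real Brownian motion with respect to the natural filtration of $W$, and $\mathbf E[W(s)u\,W(t)v]=\min(s,t)\langle u,v\rangle_{H_0}$. **Function spaces.** For $m\ge1$, $\mathcal G^m_{\mathrm b}(U,V)$ is the space of continuous maps $U\to V$ whose recursively defined Gâteaux derivatives of orders $1,\dots,m$ exist and are bounded symmetric multilinear forms, strongly continuous and uniformly bounded. For $2\le q\le\infty$ let $\mathcal S^q(H)$ be the set of random variables $X=\sum_{j} F_j h_j$ (finite sum) with $h_j\in H$ and $F_j=f_j(I(\phi_{j1}),\dots,I(\phi_{jn_j}))$,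 where $f_j\in\mathcal C^1(\mathbf R^{n_j},\mathbf R)$ has a derivative of polynomial growth, $\phi_{ji}\in L^q([0,T],H_0)$ and $I(\phi)=\int_0^T\phi\,dW$; put $D_tX=\sum_j\sum_i\partial_if_j(I(\phi_{j1}),\dots,I(\phi_{jn_j}))\,h_j\otimes\phi_{ji}(t)$. For $2\le p<\infty$, $\mathbf M^{1,p,q}(H)$ is the closure of $\mathcal S^q(H)$ under the norm $$\|X\|_{\mathbf M^{1,p,q}(H)}=\Big(\|X\|^p_{L^p(\Omega,H)}+\|DX\|^p_{L^p(\Omega,L^q([0,T],\mathcal L_2^0))}\Big)^{1/p},$$ with $D$ extended by closure. **Equation.** Let $\beta\in(0,1]$. (i) $-A$ generates an analytic semigroup $(S(t))_{t\ge0}$ on $H$, and the resolvent set of $A$ contains $(-\infty,0]$ (so that $A^{-1}\in\mathcal L(H)$ and the fractional powers of $A$ are defined). (ii) $X_0\in D(A^\beta)$ is deterministic. (iii) $\|A^{(\beta-1)/2}\|_{\mathcal L_2^0}<\infty$. (iv) $F\in\mathcal G^1_{\mathrm b}(H,H)\cap\mathcal G^2_{\mathrm b}(H,\dot H^{-1})$,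 where $\dot H^{-1}$ is the completion of $H$ in the norm $\|A^{-1/2}\cdot\|$. **Scheme.** For $h\in(0,1]$ let $V_h\subset H$ be a finite-dimensional subspace, $P_h$ the orthogonal projector onto $V_h$, and $A_h\colon V_h\to V_h$ a linear operator without eigenvalues in $(-\infty,0]$. For $k\in(0,1]$ let $t_n=nk$, let $N=N(k)$ be determined by $t_N\le T<t_N+k$, and let $S_{h,k}=(I+kA_h)^{-1}P_h$. Assume that, with constants $C$ independent of $h,k\in(0,1]$ and of $n\in\{1,\dots,N\}$, $$\|A_h^\varrho S_{h,k}^n\|_{\mathcal L}\le C\,t_n^{-\varrho},\qquad \|A_h^{-\varrho}P_hA^\varrho\|_{\mathcal L}\le C,\qquad 0\le\varrho\le\tfrac12,$$ and $$\|(S(t_n)-S_{h,k}^n)A^{\varrho/2}\|_{\mathcal L}\le C\,(h^\theta+k^{\theta/2})\,t_n^{-(\theta+\varrho)/2},\qquad 0\le\theta\le2,\ -\theta\le\varrho\le\min(1,2-\theta).$$ Let $X_{h,k}^0=P_hX_0$ and $$X_{h,k}^{n+1}=S_{h,k}X_{h,k}^n+kS_{h,k}F(X_{h,k}^n)+\int_{t_n}^{t_{n+1}}S_{h,k}\,dW(s),\qquad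 n=0,\dots,N-1.$$ **Proposition.** Let $2\le p<\infty$ and $2\le q\le\infty$, and if $\beta<1$ let moreover $q<\frac2{1-\beta}$. Then there is a constant $C<\infty$ such that, for all $h,k\in(0,1]$ and all $n\in\{1,\dots,N(k)\}$, $X_{h,k}^n\in\mathbf M^{1,p,q}(H)$ and $$\|X_{h,k}^n\|_{\mathbf M^{1,p,q}(H)}\le C.$$ -/

import Mathlib

open MeasureTheory ProbabilityTheory Filter Topology Set
open scoped ENNReal NNReal

noncomputable section

namespace SPDE

/-! ### Hilbert-Schmidt operators -/

section HilbertSchmidt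

variable (U V : Type*) [NormedAddCommGroup U] [InnerProductSpace ℝ U] [CompleteSpace U]
  [NormedAddCommGroup V] [InnerProductSpace ℝ V]

/-- The index set of a fixed orthonormal basis of the Hilbert space `U`. -/
def onbIndex : Set U := (exists_hilbertBasis ℝ U).choose

/-- A fixed orthonormal basis of the Hilbert space `U`. -/
def onb : HilbertBasis (onbIndex U) ℝ U := (exists_hilbertBasis ℝ U).choose_spec.choose

variable {U V}

/-- The squared Hilbert-Schmidt norm `∑ ‖T uᵢ‖²`, with values in `[0, ∞]`, of a bounded operator. -/
def hsSq (T : U →L[ℝ] V) : ℝ≥0∞ := ∑' i, ‖T (onb U i)‖ₑ ^ 2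

variable (U V)

/-- The vector space of Hilbert-Schmidt operators inside the bounded operators. -/
def hsSubmodule : Submodule ℝ (U →L[ℝ] V) where
  carrier := {T | Memℓp (fun i => T (onb U i)) 2}
  add_mem' hS hT := Memℓp.add hS hT
  zero_mem' := zero_memℓp
  smul_mem' c _ hT := Memℓp.const_smul hT c

/-- The space `L₂(U, V)` of Hilbert-Schmidt operators, normed by the Hilbert-Schmidt norm. -/
def HS : Type _ := hsSubmodule U V

instance : AddCommGroup (HS U V) := inferInstanceAs (AddCommGroup (hsSubmodule U V))

instance : Module ℝ (HS U V) := inferInstanceAs (Module ℝ (hsSubmodule U V))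

/-- The inclusion of the Hilbert-Schmidt operators into the bounded operators. -/
def HS.toCLM : HS U V →ₗ[ℝ] (U →L[ℝ] V) := (hsSubmodule U V).subtype

/-- The square summable family `(T uᵢ)ᵢ` of a Hilbert-Schmidt operator `T`. -/
def HS.coords : HS U V →ₗ[ℝ] lp (fun _ : onbIndex U => V) 2 where
  toFun T := ⟨fun i => HS.toCLM U V T (onb U i), T.2⟩
  map_add' _ _ := rfl
  map_smul' _ _ := rfl

theorem HS.coords_injective : Function.Injective (HS.coords U V) := by
  intro S T h
  apply Subtype.ext
  refine ContinuousLinearMap.ext_on (s := Set.range (onb U)) ?_ ?_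
  · have := (onb U).dense_span
    exact Submodule.dense_iff_topologicalClosure_eq_top.2 this
  · rintro _ ⟨i, rfl⟩
    have := congrArg (fun f : lp (fun _ : onbIndex U => V) 2 => f i) h
    exact this

instance : NormedAddCommGroup (HS U V) :=
  NormedAddCommGroup.induced (HS U V) (lp (fun _ : onbIndex U => V) 2) (HS.coords U V)
    (HS.coords_injective U V)

instance : NormedSpace ℝ (HS U V) :=
  NormedSpace.induced ℝ (HS U V) (lp (fun _ : onbIndex U => V) 2) (HS.coords U V)

variable {U V}

theorem HS.norm_def (T : HS U V) : ‖T‖ = ‖HS.coords U V T‖ := rfl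

theorem memHS_rankOne (v : V) (u : U) :
    InnerProductSpace.rankOne ℝ v u ∈ hsSubmodule U V := by
  change Memℓp (fun i => InnerProductSpace.rankOne ℝ v u (onb U i)) 2
  rw [memℓp_gen_iff (by norm_num)]
  have h := ((onb U).summable_inner_mul_inner u u).mul_right (‖v‖ ^ 2)
  refine h.congr fun i => ?_
  rw [InnerProductSpace.rankOne_apply, norm_smul, real_inner_comm (onb U i) u]
  simp [mul_pow, ← sq]

/-- The rank one operator `v ⊗ u = ⟨u, ·⟩ v` as a Hilbert-Schmidt operator, for fixed `v`, as a
continuous linear function of `u`. -/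
def hsTensor (v : V) : U →L[ℝ] HS U V :=
  LinearMap.mkContinuous
    { toFun := fun u => (⟨InnerProductSpace.rankOne ℝ v u, memHS_rankOne v u⟩ : hsSubmodule U V)
      map_add' := fun u w => Subtype.ext (map_add _ u w)
      map_smul' := fun c u => Subtype.ext
        ((InnerProductSpace.rankOne ℝ v).map_smulₛₗ c u) }
    ‖v‖ (by
      intro u
      rw [HS.norm_def]
      refine lp.norm_le_of_tsum_le (by norm_num) (by positivity) ?_
      have h := ((onb U).tsum_inner_mul_inner u u)
      have h2 : ∀ i, ‖(InnerProductSpace.rankOne ℝ v u (onb U i))‖ ^ ((2 : ℝ≥0∞).toReal)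
          = (inner ℝ u (onb U i) * inner ℝ (onb U i) u) * ‖v‖ ^ 2 := by
        intro i
        rw [InnerProductSpace.rankOne_apply, norm_smul, real_inner_comm (onb U i) u]
        simp [mul_pow, ← sq]
      refine le_of_eq ((tsum_congr h2).trans ?_)
      rw [tsum_mul_right, h, real_inner_self_eq_norm_sq]
      simp [mul_pow]
      ring)

end HilbertSchmidt

/-! ### The space `H₀ = Q^{1/2}(H)` -/

section CameronMartin

variable {H : Type*} [NormedAddCommGroup H] [InnerProductSpace ℝ H] [CompleteSpace H]

/-- For `R = Q^{1/2}`: the space `H₀ = R(H)` with `⟨u, v⟩_{H₀} = ⟨R⁻¹ u, R⁻¹ v⟩_H`, where `R⁻¹ u` is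
the preimage of `u` in the orthogonal complement of the kernel of `R`. -/
def CM (R : H →L[ℝ] H) : Type _ := LinearMap.range R.toLinearMap

variable (R : H →L[ℝ] H)

instance : AddCommGroup (CM R) := inferInstanceAs (AddCommGroup (LinearMap.range R.toLinearMap))

instance : Module ℝ (CM R) := inferInstanceAs (Module ℝ (LinearMap.range R.toLinearMap))

/-- `R` as a bijection from the orthogonal complement of its kernel onto its range. -/
def CM.ofPerp : (LinearMap.ker R.toLinearMap)ᗮ ≃ₗ[ℝ] CM R :=
  LinearEquiv.ofBijective
    (R.toLinearMap.rangeRestrict ∘ₗ (LinearMap.ker R.toLinearMap)ᗮ.subtype) (by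
      constructor
      · rw [← LinearMap.ker_eq_bot, LinearMap.ker_eq_bot']
        intro x hx
        have h1 : (x : H) ∈ LinearMap.ker R.toLinearMap := by
          have := congrArg Subtype.val hx
          simpa using this
        have h2 := Submodule.inner_right_of_mem_orthogonal h1 x.2
        exact Subtype.ext (inner_self_eq_zero.1 h2)
      · rintro ⟨_, y, rfl⟩
        have : CompleteSpace (LinearMap.ker R.toLinearMap) := R.isClosed_ker.completeSpace_coe
        obtain ⟨a, ha, b, hb, rfl⟩ :=
          (LinearMap.ker R.toLinearMap).exists_add_mem_mem_orthogonal y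
        refine ⟨⟨b, hb⟩, Subtype.ext ?_⟩
        have : R a = 0 := ha
        simp [this])

/-- The pseudo-inverse `R⁻¹ : H₀ → (ker R)ᗮ`. -/
def CM.pinv : CM R →ₗ[ℝ] (LinearMap.ker R.toLinearMap)ᗮ := (CM.ofPerp R).symm.toLinearMap

instance : NormedAddCommGroup (CM R) :=
  NormedAddCommGroup.induced (CM R) (LinearMap.ker R.toLinearMap)ᗮ (CM.pinv R)
    (CM.ofPerp R).symm.injective

instance : InnerProductSpace ℝ (CM R) := InnerProductSpace.induced (CM.pinv R)

instance : CompleteSpace (CM R) := by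
  have e : CM R ≃ₗᵢ[ℝ] (LinearMap.ker R.toLinearMap)ᗮ :=
    ⟨(CM.ofPerp R).symm, fun _ => rfl⟩
  exact (completeSpace_congr (e := e.toEquiv) e.isometry.isUniformEmbedding).2 inferInstance

/-- The continuous inclusion `H₀ → H`. -/
def CM.incl : CM R →L[ℝ] H :=
  LinearMap.mkContinuous (LinearMap.range R.toLinearMap).subtype ‖R‖ (by
    intro u
    obtain ⟨x, rfl⟩ := (CM.ofPerp R).surjective u
    have h : ‖CM.ofPerp R x‖ = ‖x‖ := by
      change ‖(CM.ofPerp R).symm (CM.ofPerp R x)‖ = ‖x‖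
      rw [LinearEquiv.symm_apply_apply]
    rw [h]
    exact R.le_opNorm x)

end CameronMartin

/-! ### Cylindrical Wiener process and Wiener integral -/

section Wiener

variable {Ω : Type*} [MeasurableSpace Ω] (P : Measure Ω)
  {U : Type*} [NormedAddCommGroup U] [InnerProductSpace ℝ U] [CompleteSpace U]
  {G : Type*} [NormedAddCommGroup G] [InnerProductSpace ℝ G]

/-- The σ-algebra generated by `W r v`, `0 ≤ r ≤ s`, `v ∈ U`. -/
abbrev pastSigma (W : ℝ → U →L[ℝ] Lp ℝ 2 P) (s : ℝ) : MeasurableSpace Ω :=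
  ⨆ r ∈ Icc 0 s, ⨆ v : U, MeasurableSpace.comap (W r v : Ω → ℝ) inferInstance

/-- `W ∈ C([0,T], L(U, L²(Ω)))` is a cylindrical Wiener process on `U` with respect to its natural
filtration: each `t ↦ W t u` is (up to modification) a real Brownian motion, with increments that
are independent of the past of the whole process, and
`E[W s u * W t v] = min s t * ⟨u, v⟩`. With `U = Q^{1/2}(H)` this is a cylindrical `Q`-Wiener
process. -/
structure IsCylindricalWiener (T : ℝ) (W : ℝ → U →L[ℝ] Lp ℝ 2 P) : Prop where
  continuousOn : ContinuousOn W (Icc 0 T)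
  gaussian : ∀ u : U, ∀ s t : ℝ, 0 ≤ s → s ≤ t → t ≤ T →
    P.map (fun ω => W t u ω - W s u ω) = gaussianReal 0 (Real.toNNReal ((t - s) * ‖u‖ ^ 2))
  indep : ∀ u : U, ∀ s t : ℝ, 0 ≤ s → s ≤ t → t ≤ T →
    Indep (MeasurableSpace.comap (fun ω => W t u ω - W s u ω) inferInstance) (pastSigma P W s) P
  covariance : ∀ u v : U, ∀ s ∈ Icc 0 T, ∀ t ∈ Icc 0 T,
    ∫ ω, W s u ω * W t v ω ∂P = min s t * inner ℝ u v
  paths : ∀ u : U, ∃ B : ℝ → Ω → ℝ, (∀ t ∈ Icc 0 T, B t =ᵐ[P] W t u) ∧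
    ∀ ω, ContinuousOn (fun t => B t ω) (Icc 0 T)

/-- A deterministic elementary integrand `∑ᵢ 1_{(aᵢ, bᵢ]} gᵢ ⊗ uᵢ` on `[0, T]`. -/
structure ElemIntegrand (T : ℝ) (U G : Type*) where
  m : ℕ
  a : Fin m → ℝ
  b : Fin m → ℝ
  u : Fin m → U
  g : Fin m → G
  nonneg : ∀ i, 0 ≤ a i
  le : ∀ i, a i ≤ b i
  le_T : ∀ i, b i ≤ T

/-- The elementary integrand as a function of time with values in the operators `U → G`. -/
def ElemIntegrand.fn {T : ℝ} (s : ElemIntegrand T U G) (t : ℝ) : U →L[ℝ] G :=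
  ∑ i, (Ioc (s.a i) (s.b i)).indicator
    (fun _ => InnerProductSpace.rankOne ℝ (s.g i) (s.u i)) t

variable {P}

/-- The integral `∑ᵢ (W(bᵢ)uᵢ - W(aᵢ)uᵢ) gᵢ` of an elementary integrand. -/
def ElemIntegrand.integral {T : ℝ} (s : ElemIntegrand T U G) (W : ℝ → U →L[ℝ] Lp ℝ 2 P)
    (ω : Ω) : G :=
  ∑ i, (W (s.b i) (s.u i) ω - W (s.a i) (s.u i) ω) • s.g i

/-- `Y = ∫₀ᵀ Φ(t) dW(t)` for a deterministic `Φ ∈ L²([0,T], L₂(U, G))`: `Y` is the `L²(Ω, G)`-limit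
of the integrals of elementary integrands that converge to `Φ` in `L²([0,T], L₂(U, G))`. -/
def IsWienerIntegral (T : ℝ) (W : ℝ → U →L[ℝ] Lp ℝ 2 P) (Φ : ℝ → U →L[ℝ] G) (Y : Ω → G) : Prop :=
  AEStronglyMeasurable Y P ∧ ∃ s : ℕ → ElemIntegrand T U G,
    Tendsto (fun m => ∫⁻ t in Icc 0 T, hsSq (Φ t - (s m).fn t)) atTop (𝓝 0) ∧
    Tendsto (fun m => eLpNorm (fun ω => Y ω - (s m).integral W ω) 2 P) atTop (𝓝 0)

end Wiener

/-! ### Refined Sobolev-Malliavin spaces -/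

section Malliavin

variable {Ω : Type*} [MeasurableSpace Ω] {P : Measure Ω}
  {U : Type*} [NormedAddCommGroup U] [InnerProductSpace ℝ U] [CompleteSpace U]
  {H : Type*} [NormedAddCommGroup H] [InnerProductSpace ℝ H]

/-- `f ∈ C¹(ℝⁿ, ℝ)` with derivative of polynomial growth. -/
def IsCp1 {n : ℕ} (f : (Fin n → ℝ) → ℝ) : Prop :=
  ContDiff ℝ 1 f ∧ ∃ (C : ℝ) (r : ℕ), ∀ x, ‖fderiv ℝ f x‖ ≤ C * (1 + ‖x‖ ^ r)

/-- `F = f(I(φ₁), …, I(φₙ))` with `f ∈ C_p¹`, `φᵢ ∈ L^q([0,T], U)`, where `I` is the Wiener integral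
(`L²([0,T], U)` being identified with `L²([0,T], L₂(U, ℝ))`), and
`DF = ∑ᵢ ∂ᵢf(I(φ₁), …, I(φₙ)) φᵢ`. -/
def IsSmoothReal (T : ℝ) (W : ℝ → U →L[ℝ] Lp ℝ 2 P) (q : ℝ≥0∞)
    (F : Ω → ℝ) (DF : Ω → Lp U q (volume.restrict (Icc 0 T))) : Prop :=
  ∃ (n : ℕ) (f : (Fin n → ℝ) → ℝ) (φ : Fin n → Lp U q (volume.restrict (Icc 0 T)))
    (Y : Fin n → Ω → ℝ),
    IsCp1 f ∧ (∀ i, IsWienerIntegral T W (fun t => innerSL ℝ (φ i t)) (Y i)) ∧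
    (∀ᵐ ω ∂P, F ω = f fun i => Y i ω) ∧
    ∀ᵐ ω ∂P, DF ω = ∑ i, fderiv ℝ f (fun j => Y j ω) (Pi.single i 1) • φ i

/-- `X = ∑ⱼ Fⱼ hⱼ` with `hⱼ ∈ H` and smooth real random variables `Fⱼ`, and `DX = ∑ⱼ hⱼ ⊗ DFⱼ`. -/
def IsSmooth (T : ℝ) (W : ℝ → U →L[ℝ] Lp ℝ 2 P) (q : ℝ≥0∞)
    (X : Ω → H) (DX : Ω → Lp (HS U H) q (volume.restrict (Icc 0 T))) : Prop :=
  ∃ (m : ℕ) (h : Fin m → H) (F : Fin m → Ω → ℝ)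
    (DF : Fin m → Ω → Lp U q (volume.restrict (Icc 0 T))),
    (∀ j, IsSmoothReal T W q (F j) (DF j)) ∧
    (∀ᵐ ω ∂P, X ω = ∑ j, F j ω • h j) ∧
    ∀ᵐ ω ∂P, DX ω = ∑ j, (hsTensor (h j)).compLp (DF j ω)

/-- `X` belongs to the domain of the closure of the Malliavin derivative, as an operator from
`L^p(Ω, H)` to `L^p(Ω, L^q([0,T], L₂(U, H)))` with initial domain the smooth random variables, and
`DX` is its derivative. -/
def HasMalliavinDeriv (T : ℝ) (W : ℝ → U →L[ℝ] Lp ℝ 2 P) (p q : ℝ≥0∞) [Fact (1 ≤ q)]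
    (X : Ω → H) (DX : Ω → Lp (HS U H) q (volume.restrict (Icc 0 T))) : Prop :=
  MemLp X p P ∧ MemLp DX p P ∧
  ∃ (x : ℕ → Ω → H) (dx : ℕ → Ω → Lp (HS U H) q (volume.restrict (Icc 0 T))),
    (∀ m, IsSmooth T W q (x m) (dx m)) ∧
    Tendsto (fun m => eLpNorm (fun ω => X ω - x m ω) p P) atTop (𝓝 0) ∧
    Tendsto (fun m => eLpNorm (fun ω => DX ω - dx m ω) p P) atTop (𝓝 0)

/-- The norm of `M^{1,p,q}(H)`, equal to `∞` outside this space. The derivative over which the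
infimum is taken is almost surely unique, because the Malliavin derivative is closable. -/
def malliavinNorm (T : ℝ) (W : ℝ → U →L[ℝ] Lp ℝ 2 P) (p q : ℝ≥0∞) [Fact (1 ≤ q)]
    (X : Ω → H) : ℝ≥0∞ :=
  ⨅ (DX : Ω → Lp (HS U H) q (volume.restrict (Icc 0 T))) (_ : HasMalliavinDeriv T W p q X DX),
    (eLpNorm X p P ^ p.toReal + eLpNorm DX p P ^ p.toReal) ^ (1 / p.toReal)

end Malliavin

/-! ### Fractional powers and analytic semigroups -/

section Operators

variable {E : Type*} [NormedAddCommGroup E] [NormedSpace ℝ E]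

/-- `R ∈ L(E)` is the inverse of `l + A`. -/
def IsShiftInverse (A : E →ₗ.[ℝ] E) (l : ℝ) (R : E →L[ℝ] E) : Prop :=
  (∀ x : E, ∃ hx : R x ∈ A.domain, l • R x + A ⟨R x, hx⟩ = x) ∧
  ∀ x : A.domain, R (l • (x : E) + A x) = x

open Classical in
/-- `(l + A)⁻¹ ∈ L(E)` (zero if this inverse does not exist). -/
def shiftInverse (A : E →ₗ.[ℝ] E) (l : ℝ) : E →L[ℝ] E :=
  if h : ∃ R, IsShiftInverse A l R then h.choose else 0

/-- The bounded operator `A^{-α}`, `α ≥ 0`, for an operator `A` with `(-∞, 0]` in its resolvent set: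
`A^{-α} = (A⁻¹)^{⌊α⌋} A^{-(α - ⌊α⌋)}` and, for `0 < α < 1`,
`A^{-α} = (sin (π α) / π) ∫₀^∞ t^{-α} (t + A)⁻¹ dt`. -/
def negPow (A : E →ₗ.[ℝ] E) (α : ℝ) : E →L[ℝ] E :=
  (shiftInverse A 0) ^ ⌊α⌋₊ *
    (if Int.fract α = 0 then 1 else
      (Real.sin (Real.pi * Int.fract α) / Real.pi) •
        ∫ t in Ioi (0 : ℝ), t ^ (-Int.fract α) • shiftInverse A t)

/-- `x ∈ D(A^r)` and `y = A^r x`. For `r ≥ 0` the operator `A^r` is the inverse of the bounded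
injective operator `A^{-r}`, with domain the range of `A^{-r}`. -/
def IsFracPow (A : E →ₗ.[ℝ] E) (r : ℝ) (x y : E) : Prop :=
  (0 ≤ r ∧ negPow A r y = x) ∨ (r < 0 ∧ y = negPow A (-r) x)

/-- `-A` is the generator of the analytic semigroup `S` of bounded operators on `E`. (For a strongly
continuous semigroup on a real space, analyticity means that `S t` maps into `D(A)` for `t > 0`, with
`‖A S(t)‖ ≤ C / t` for small `t`.) -/
structure IsAnalyticSemigroup (A : E →ₗ.[ℝ] E) (S : ℝ → E →L[ℝ] E) : Prop where
  zero : S 0 = 1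
  add : ∀ s t : ℝ, 0 ≤ s → 0 ≤ t → S (s + t) = S s * S t
  strongCont : ∀ x : E, ContinuousOn (fun t => S t x) (Ici 0)
  generator : ∀ x y : E, (x, y) ∈ A.graph ↔
    Tendsto (fun t : ℝ => t⁻¹ • (x - S t x)) (𝓝[>] 0) (𝓝 y)
  analytic : ∃ C : ℝ, ∀ t ∈ Ioc (0 : ℝ) 1, ∀ x : E,
    ∃ hx : S t x ∈ A.domain, ‖A ⟨S t x, hx⟩‖ ≤ C / t * ‖x‖

end Operators

/-! ### The space `Ḣ⁻¹` -/

section NegativeSpace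

variable {H : Type*} [NormedAddCommGroup H] [NormedSpace ℝ H]

/-- `H` with the norm `x ↦ ‖L x‖`. -/
def Renormed (_L : H →L[ℝ] H) : Type _ := H

variable (L : H →L[ℝ] H)

instance : AddCommGroup (Renormed L) := inferInstanceAs (AddCommGroup H)

instance : Module ℝ (Renormed L) := inferInstanceAs (Module ℝ H)

/-- `L` as a map on the renormed space. -/
def Renormed.map : Renormed L →ₗ[ℝ] H := L.toLinearMap

instance : SeminormedAddCommGroup (Renormed L) :=
  SeminormedAddCommGroup.induced (Renormed L) H (Renormed.map L)

instance : NormedSpace ℝ (Renormed L) := NormedSpace.induced ℝ (Renormed L) H (Renormed.map L)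

/-- `Ḣ⁻¹`: the completion of `H` with respect to the norm `‖A^{-1/2} x‖`. -/
abbrev HMinusOne (A : H →ₗ.[ℝ] H) : Type _ :=
  UniformSpace.Completion (Renormed (negPow A (1 / 2)))

/-- The canonical map `H → Ḣ⁻¹`. -/
def toHMinusOne (A : H →ₗ.[ℝ] H) (x : H) : HMinusOne A :=
  ((show Renormed (negPow A (1 / 2)) from x) : UniformSpace.Completion _)

end NegativeSpace

/-! ### Gâteaux differentiable maps -/

section Gateaux

variable {U V : Type*} [NormedAddCommGroup U] [NormedSpace ℝ U]
  [NormedAddCommGroup V] [NormedSpace ℝ V]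

/-- `φ ∈ G_b^m(U, V)`, `m ≥ 1`: the map `φ` is continuous and has, up to the order `m`, recursively
defined Gâteaux derivatives `φ⁽ʲ⁾ = D j` that are bounded symmetric multilinear forms, strongly
continuous and uniformly bounded. -/
def MemGb (m : ℕ) (φ : U → V) : Prop :=
  Continuous φ ∧
  ∃ D : (j : ℕ) → U → ContinuousMultilinearMap ℝ (fun _ : Fin j => U) V,
    (∀ x u, D 0 x u = φ x) ∧
    (∀ j < m, ∀ (x : U) (u : Fin (j + 1) → U),
      Tendsto (fun ε : ℝ => ε⁻¹ •
          (D j (x + ε • u (Fin.last j)) (Fin.init u) - D j x (Fin.init u)))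
        (𝓝[≠] 0) (𝓝 (D (j + 1) x u))) ∧
    ∀ j, 1 ≤ j → j ≤ m →
      (∀ x u, ∀ σ : Equiv.Perm (Fin j), D j x (fun i => u (σ i)) = D j x u) ∧
      (∀ u, Continuous fun x => D j x u) ∧
      ∃ C : ℝ, ∀ x, ‖D j x‖ ≤ C

end Gateaux

/-! ### The equation and its discretization -/

section Equation

variable {H : Type*} [NormedAddCommGroup H] [InnerProductSpace ℝ H] [CompleteSpace H]

/-- Assumptions on the equation `dX + A X dt = F(X) dt + dW`, `X(0) = X₀`, where `R = Q^{1/2}`. -/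
structure EquationAssumptions (A : H →ₗ.[ℝ] H) (S : ℝ → H →L[ℝ] H) (X₀ : H) (β : ℝ)
    (R : H →L[ℝ] H) (F : H → H) : Prop where
  /-- `-A` generates the analytic semigroup `S`. -/
  semigroup : IsAnalyticSemigroup A S
  /-- `A⁻¹ ∈ L(H)` and, so that the fractional powers of `A` are defined, the resolvent set of `A`
  contains `(-∞, 0]`. -/
  resolvent : ∀ l : ℝ, 0 ≤ l → ∃ B, IsShiftInverse A l B
  /-- `X₀ ∈ D(A^β)`. -/
  initial : ∃ y, IsFracPow A β X₀ y
  /-- `A^{(β-1)/2}` is a Hilbert-Schmidt operator from `H₀` to `H`. -/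
  noise : hsSq (negPow A ((1 - β) / 2) ∘L CM.incl R) < ∞
  /-- `F ∈ G_b¹(H, H) ∩ G_b²(H, Ḣ⁻¹)`. -/
  drift₁ : MemGb 1 F
  drift₂ : MemGb 2 fun x => toHMinusOne A (F x)

/-- The number `N` of time steps: `N k ≤ T < (N + 1) k`. -/
def numSteps (T k : ℝ) : ℕ := ⌊T / k⌋₊

variable (V : Ioc (0 : ℝ) 1 → Submodule ℝ H) [∀ h, FiniteDimensional ℝ (V h)]
  (Ah : ∀ h, V h →ₗ[ℝ] V h)

/-- `S_{h,k} = (I + k A_h)⁻¹ P_h`. -/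
def schemeOp (h : Ioc (0 : ℝ) 1) (k : ℝ) : H →L[ℝ] H :=
  (V h).subtypeL ∘L
    Ring.inverse (1 + k • LinearMap.toContinuousLinearMap (Ah h)) ∘L
    (V h).orthogonalProjectionOnto

/-- Assumptions on the discretization. -/
structure SchemeAssumptions (T : ℝ) (A : H →ₗ.[ℝ] H) (S : ℝ → H →L[ℝ] H) : Prop where
  /-- No point of `(-∞, 0]` is an eigenvalue of `A_h`, so that `(I + k A_h)⁻¹` and the fractional
  powers of `A_h` are defined. -/
  resolvent : ∀ h, ∀ l : ℝ, 0 ≤ l → ∃ B, IsShiftInverse ((Ah h).toPMap ⊤) l B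
  /-- `‖A_h^ρ S_{h,k}^n‖ ≤ C t_n^{-ρ}`. -/
  smoothing : ∀ ρ : ℝ, 0 ≤ ρ → ρ ≤ 1 / 2 → ∃ C : ℝ, ∀ h, ∀ k ∈ Ioc (0 : ℝ) 1,
    ∀ n : ℕ, 1 ≤ n → n ≤ numSteps T k → ∀ (x : H) (y z : V h),
      (y : H) = (schemeOp V Ah h k ^ n) x → IsFracPow ((Ah h).toPMap ⊤) ρ y z →
      ‖z‖ ≤ C * (n * k) ^ (-ρ) * ‖x‖
  /-- `‖A_h^{-ρ} P_h A^ρ‖ ≤ C`. -/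
  compat : ∀ ρ : ℝ, 0 ≤ ρ → ρ ≤ 1 / 2 → ∃ C : ℝ, ∀ h, ∀ x y : H, IsFracPow A ρ x y →
    ‖negPow ((Ah h).toPMap ⊤) ρ ((V h).orthogonalProjectionOnto y)‖ ≤ C * ‖x‖
  /-- `‖(S(t_n) - S_{h,k}^n) A^{ρ/2}‖ ≤ C (h^θ + k^{θ/2}) t_n^{-(θ+ρ)/2}`. -/
  error : ∀ θ ρ : ℝ, 0 ≤ θ → θ ≤ 2 → -θ ≤ ρ → ρ ≤ min 1 (2 - θ) →
    ∃ C : ℝ, ∀ h : Ioc (0 : ℝ) 1, ∀ k ∈ Ioc (0 : ℝ) 1,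
    ∀ n : ℕ, 1 ≤ n → n ≤ numSteps T k → ∀ x y : H, IsFracPow A (ρ / 2) x y →
      ‖S (n * k) y - (schemeOp V Ah h k ^ n) y‖ ≤
        C * ((h : ℝ) ^ θ + k ^ (θ / 2)) * (n * k) ^ (-((θ + ρ) / 2)) * ‖x‖

variable {Ω : Type*} [MeasurableSpace Ω] {P : Measure Ω}

/-- `(X n)`, `0 ≤ n ≤ N`, is the semi-implicit Euler-Maruyama approximation with parameters `h`, `k`:
`X 0 = P_h X₀` and
`X (n+1) = S_{h,k} X n + k S_{h,k} F(X n) + ∫_{t_n}^{t_{n+1}} S_{h,k} dW`, almost surely. -/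
def IsScheme (T : ℝ) (F : H → H) (X₀ : H) (R : H →L[ℝ] H) (W : ℝ → CM R →L[ℝ] Lp ℝ 2 P)
    (h : Ioc (0 : ℝ) 1) (k : ℝ) (X : ℕ → Ω → H) : Prop :=
  (∀ᵐ ω ∂P, X 0 ω = (V h).orthogonalProjectionOnto X₀) ∧
  ∀ n < numSteps T k, ∃ Y : Ω → H,
    IsWienerIntegral T W ((Ioc (n * k) ((n + 1) * k)).indicator
      fun _ => schemeOp V Ah h k ∘L CM.incl R) Y ∧
    ∀ᵐ ω ∂P, X (n + 1) ω =
      schemeOp V Ah h k (X n ω) + k • schemeOp V Ah h k (F (X n ω)) + Y ω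

end Equation

end SPDE

end

/-!
Since `V_h` is finite-dimensional, the noise enters each step only through the finitely many
coordinates of `∫ S_{h,k} dW` in an orthonormal basis of `V_h`, and these are increments of real
Brownian motions (`IsWienerIntegral.ae_eq_blockIncrement`, by the Itô isometry
`IsCylindricalWiener.eLpNorm_integral_sq`). Hence `X_{h,k}^n = G_n(ξ)` almost surely, where `ξ` is
the vector of these increments and `G_n = schemeMap … n` is given by the recursion of the scheme. On
a finite-dimensional space the Gâteaux differentiable drift `F` is continuously differentiable
(`IsGateauxDeriv.contDiff`), so that `G_n` is continuously differentiable with bounded derivative.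
Therefore `X_{h,k}^n` is itself a smooth random variable (`isSmooth_of_contDiff`), with derivative
`tangentLp φ (G_n' ξ)`, and its membership in `M^{1,p,q}` needs no approximation.

What remains are bounds that are uniform in `h`, `k`, `n`. With `γ = (1 - β) / 2`, the smoothing
property of the scheme and the comparison of `A_h^{-γ}` with `A^{-γ}` give
`‖S_{h,k}^m‖_{L₂⁰} ≤ M t_m^{-γ}` (`SchemeAssumptions.exists_hsSq_le`); here one uses that the resolvent
of `A_h` commutes with `A_h^{-γ}` (`commute_negPow`).

* The derivative solves the linearized recursion. By variation of constants and `q γ < 1`, its free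
  term `∑_j 1_{(t_j, t_{j+1}]} S_{h,k}^{n-j}` is bounded in `L^q([0,T], L₂⁰)`
  (`exists_eLpNorm_step_le`), and a discrete Gronwall inequality bounds the derivative uniformly in
  the random parameter (`enorm_tangentLp_schemeMap_le`).
* The coordinates of the stochastic convolution are Gaussian, so that its `L^p` norm is controlled by
  its `L²` norm (`IsCylindricalWiener.eLpNorm_sum_blockIncrement_sq_le`), which is bounded because
  `2 γ = 1 - β < 1`. The linear growth of `F` and the discrete Gronwall inequality bound the moments of
  `X_{h,k}^n` (`eLpNorm_le_of_recursion`).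
-/

noncomputable section

namespace SPDE

/-! ### Hilbert-Schmidt operators -/

section HilbertSchmidtLemmas

variable {U G K : Type*} [NormedAddCommGroup U] [InnerProductSpace ℝ U] [CompleteSpace U]
  [NormedAddCommGroup G] [InnerProductSpace ℝ G] [NormedAddCommGroup K] [InnerProductSpace ℝ K]

theorem HS.toCLM_injective : Function.Injective (HS.toCLM U G) := Subtype.val_injective

theorem HS.toCLM_mem (T : HS U G) : HS.toCLM U G T ∈ hsSubmodule U G := T.2

theorem HS.toCLM_hsTensor (v : G) (u : U) :
    HS.toCLM U G (hsTensor v u) = InnerProductSpace.rankOne ℝ v u := rfl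

theorem HS.enorm_sq (T : HS U G) : ‖T‖ₑ ^ 2 = hsSq (HS.toCLM U G T) := by
  have h := lp.hasSum_norm (p := 2) (by norm_num) (HS.coords U G T)
  have h2 : ∀ i, ‖HS.coords U G T i‖ ^ ((2 : ℝ≥0∞).toReal) = ‖HS.toCLM U G T (onb U i)‖ ^ 2 := by
    intro i
    rw [show (2 : ℝ≥0∞).toReal = (2 : ℕ) by norm_num, Real.rpow_natCast]
    rfl
  simp only [h2] at h
  rw [← HS.norm_def] at h
  norm_num at h
  rw [hsSq, ← ofReal_norm, ← ENNReal.ofReal_pow (norm_nonneg _), ← h.tsum_eq,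
    ENNReal.ofReal_tsum_of_nonneg (fun i => by positivity) h.summable]
  refine tsum_congr fun i => ?_
  rw [ENNReal.ofReal_pow (norm_nonneg _), ofReal_norm]

theorem hsSq_comp_le (B : G →L[ℝ] K) (T : U →L[ℝ] G) :
    hsSq (B ∘L T) ≤ ‖B‖ₑ ^ 2 * hsSq T := by
  rw [hsSq, hsSq, ← ENNReal.tsum_mul_left]
  refine ENNReal.tsum_le_tsum fun i => ?_
  rw [← mul_pow]
  gcongr
  exact B.le_opENorm _

theorem hsSq_le_of_norm_le {T : U →L[ℝ] G} {T' : U →L[ℝ] K} {c : ℝ≥0∞}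
    (h : ∀ x, ‖T x‖ₑ ≤ c * ‖T' x‖ₑ) : hsSq T ≤ c ^ 2 * hsSq T' := by
  rw [hsSq, hsSq, ← ENNReal.tsum_mul_left]
  refine ENNReal.tsum_le_tsum fun i => ?_
  rw [← mul_pow]
  gcongr
  exact h _

theorem HS.comp_mem (B : G →L[ℝ] K) (T : HS U G) : B ∘L HS.toCLM U G T ∈ hsSubmodule U K := by
  change Memℓp (fun i => B (HS.toCLM U G T (onb U i))) 2
  have h : Memℓp (fun i => HS.toCLM U G T (onb U i)) 2 := HS.toCLM_mem T
  rw [memℓp_gen_iff (by norm_num)] at h ⊢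
  refine .of_nonneg_of_le (fun i => by positivity) (fun i => ?_)
    (h.mul_left (‖B‖ ^ (2 : ℝ≥0∞).toReal))
  rw [← Real.mul_rpow (norm_nonneg _) (norm_nonneg _)]
  gcongr
  exact B.le_opNorm _

/-- Composition with a bounded operator on the left, as a linear map on Hilbert-Schmidt operators. -/
def HS.lcompₗ (B : G →L[ℝ] K) : HS U G →ₗ[ℝ] HS U K where
  toFun T := (⟨B ∘L HS.toCLM U G T, HS.comp_mem B T⟩ : hsSubmodule U K)
  map_add' S T := HS.toCLM_injective (by
    change B ∘L (HS.toCLM U G (S + T)) = B ∘L HS.toCLM U G S + B ∘L HS.toCLM U G T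
    rw [map_add, ContinuousLinearMap.comp_add])
  map_smul' c T := HS.toCLM_injective (by
    change B ∘L (HS.toCLM U G (c • T)) = c • (B ∘L HS.toCLM U G T)
    rw [map_smul, ContinuousLinearMap.comp_smul])

theorem HS.toCLM_lcompₗ (B : G →L[ℝ] K) (T : HS U G) :
    HS.toCLM U K (HS.lcompₗ B T) = B ∘L HS.toCLM U G T := rfl

theorem HS.norm_lcompₗ_le (B : G →L[ℝ] K) (T : HS U G) : ‖HS.lcompₗ B T‖ ≤ ‖B‖ * ‖T‖ := by
  have h := hsSq_comp_le B (HS.toCLM U G T)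
  rw [← HS.enorm_sq, ← HS.toCLM_lcompₗ, ← HS.enorm_sq, ← mul_pow] at h
  have h2 := (ENNReal.pow_right_strictMono two_ne_zero).le_iff_le.1 h
  rwa [← ofReal_norm, ← ofReal_norm, ← ofReal_norm, ← ENNReal.ofReal_mul (norm_nonneg _),
    ENNReal.ofReal_le_ofReal_iff (by positivity)] at h2

/-- Composition with a bounded operator on the left, as a bounded operator on Hilbert-Schmidt
operators. -/
def HS.lcomp (B : G →L[ℝ] K) : HS U G →L[ℝ] HS U K :=
  (HS.lcompₗ B).mkContinuous ‖B‖ (HS.norm_lcompₗ_le B)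

theorem HS.toCLM_lcomp (B : G →L[ℝ] K) (T : HS U G) :
    HS.toCLM U K (HS.lcomp B T) = B ∘L HS.toCLM U G T := rfl

theorem HS.norm_lcomp_le (B : G →L[ℝ] K) : ‖(HS.lcomp B : HS U G →L[ℝ] HS U K)‖ ≤ ‖B‖ :=
  LinearMap.mkContinuous_norm_le _ (norm_nonneg _) _

theorem HS.lcomp_hsTensor (B : G →L[ℝ] K) (v : G) (u : U) :
    HS.lcomp B (hsTensor v u) = hsTensor (B v) u := by
  apply HS.toCLM_injective
  ext x
  simp only [HS.toCLM_lcomp, HS.toCLM_hsTensor, ContinuousLinearMap.comp_apply,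
    InnerProductSpace.rankOne_apply, map_smul]

theorem hsTensor_add (v w : G) : (hsTensor (v + w) : U →L[ℝ] HS U G) = hsTensor v + hsTensor w := by
  ext1 u
  apply HS.toCLM_injective
  ext x
  simp [HS.toCLM_hsTensor]

theorem hsTensor_smul (c : ℝ) (v : G) :
    (hsTensor (c • v) : U →L[ℝ] HS U G) = c • hsTensor v := by
  ext1 u
  apply HS.toCLM_injective
  ext x
  simp [HS.toCLM_hsTensor]

variable {α : Type*} [MeasurableSpace α] {μ : Measure α} {q : ℝ≥0∞}

/-- The function `t ↦ v ⊗ φ t`, as a linear function of `v`. -/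
def tensorLp (φ : Lp U q μ) : G →ₗ[ℝ] Lp (HS U G) q μ where
  toFun v := (hsTensor v).compLp φ
  map_add' v w := by rw [hsTensor_add, ContinuousLinearMap.add_compLp]
  map_smul' c v := by rw [hsTensor_smul, ContinuousLinearMap.smul_compLp]; rfl

theorem tensorLp_apply (φ : Lp U q μ) (v : G) : tensorLp φ v = (hsTensor v).compLp φ := rfl

theorem tensorLp_sum {ι : Type*} (s : Finset ι) (c : ι → ℝ) (φ : ι → Lp U q μ) (v : G) :
    tensorLp (∑ i ∈ s, c i • φ i) v = ∑ i ∈ s, c i • tensorLp (φ i) v := by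
  change (hsTensor v).compLpₗ q μ (∑ i ∈ s, c i • φ i) = _
  rw [map_sum]
  simp only [map_smul]
  rfl

theorem compLp_tensorLp (B : G →L[ℝ] K) (φ : Lp U q μ) (v : G) :
    (HS.lcomp B).compLp (tensorLp φ v) = tensorLp φ (B v) := by
  apply Lp.ext
  rw [tensorLp_apply, tensorLp_apply]
  filter_upwards [(HS.lcomp B).coeFn_compLp ((hsTensor v).compLp φ), (hsTensor v).coeFn_compLp φ,
    (hsTensor (B v)).coeFn_compLp φ] with t h1 h2 h3
  rw [h1, h2, h3, HS.lcomp_hsTensor]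

theorem enorm_compLp_lcomp_le [Fact (1 ≤ q)] (B : G →L[ℝ] K) {c : ℝ} (hB : ‖B‖ ≤ c)
    (f : Lp (HS U G) q μ) :
    ‖(HS.lcomp B).compLp f‖ₑ ≤ ENNReal.ofReal c * ‖f‖ₑ := by
  have hc : 0 ≤ c := (norm_nonneg B).trans hB
  have h : ‖(HS.lcomp B).compLp f‖ ≤ c * ‖f‖ :=
    (ContinuousLinearMap.norm_compLp_le _ _).trans
      (mul_le_mul_of_nonneg_right ((HS.norm_lcomp_le B).trans hB) (norm_nonneg f))
  rw [← ofReal_norm, ← ofReal_norm, ← ENNReal.ofReal_mul hc]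
  exact ENNReal.ofReal_le_ofReal h

theorem compLp_indicatorConstLp {E E' : Type*} [NormedAddCommGroup E] [NormedSpace ℝ E]
    [NormedAddCommGroup E'] [NormedSpace ℝ E'] (B : E →L[ℝ] E') {s : Set α} (hs : MeasurableSet s)
    (hμs : μ s ≠ ∞) (c : E) :
    B.compLp (indicatorConstLp q hs hμs c) = indicatorConstLp q hs hμs (B c) := by
  apply Lp.ext
  filter_upwards [B.coeFn_compLp (indicatorConstLp q hs hμs c),
    indicatorConstLp_coeFn (p := q) (hs := hs) (hμs := hμs) (c := c),
    indicatorConstLp_coeFn (p := q) (hs := hs) (hμs := hμs) (c := B c)] with t h1 h2 h3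
  rw [h1, h2, h3]
  by_cases ht : t ∈ s <;> simp [ht]

/-- Parseval's identity for the Hilbert-Schmidt inner product of finite sums of rank one operators. -/
theorem hasSum_norm_sum_rankOne_sq {ι : Type*} (s : Finset ι) (c : ι → ℝ) (g : ι → G) (u : ι → U) :
    HasSum (fun l => ‖(∑ i ∈ s, c i • InnerProductSpace.rankOne ℝ (g i) (u i)) (onb U l)‖ ^ 2)
      (∑ i ∈ s, ∑ j ∈ s, c i * c j * (inner ℝ (g i) (g j) * inner ℝ (u i) (u j))) := by
  have h1 : HasSum (fun l => ∑ i ∈ s, ∑ j ∈ s, c i * c j * (inner ℝ (g i) (g j) *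
      (inner ℝ (u i) (onb U l) * inner ℝ (onb U l) (u j))))
      (∑ i ∈ s, ∑ j ∈ s, c i * c j * (inner ℝ (g i) (g j) * inner ℝ (u i) (u j))) :=
    hasSum_sum fun i _ => hasSum_sum fun j _ =>
      (((onb U).hasSum_inner_mul_inner (u i) (u j)).mul_left _).mul_left _
  refine h1.congr_fun fun l => ?_
  rw [← real_inner_self_eq_norm_sq, _root_.sum_apply, sum_inner]
  refine Finset.sum_congr rfl fun i _ => ?_
  rw [inner_sum]
  refine Finset.sum_congr rfl fun j _ => ?_
  simp only [_root_.smul_apply, InnerProductSpace.rankOne_apply, inner_smul_left,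
    inner_smul_right]
  rw [real_inner_comm (onb U l) (u j)]
  simp
  ring

theorem hsSq_sum_rankOne {ι : Type*} (s : Finset ι) (c : ι → ℝ) (g : ι → G) (u : ι → U) :
    hsSq (∑ i ∈ s, c i • InnerProductSpace.rankOne ℝ (g i) (u i)) =
      ENNReal.ofReal (∑ i ∈ s, ∑ j ∈ s, c i * c j * (inner ℝ (g i) (g j) * inner ℝ (u i) (u j))) := by
  have h := hasSum_norm_sum_rankOne_sq s c g u
  rw [hsSq, ← h.tsum_eq, ENNReal.ofReal_tsum_of_nonneg (fun i => by positivity) h.summable]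
  refine tsum_congr fun i => ?_
  rw [ENNReal.ofReal_pow (norm_nonneg _), ofReal_norm]

variable [CompleteSpace G]

/-- An operator with values in a finite-dimensional subspace is a sum of rank one operators. -/
theorem sum_rankOne_adjoint (V : Submodule ℝ G) [FiniteDimensional ℝ V] (Φ : U →L[ℝ] G)
    (hΦ : ∀ x, Φ x ∈ V) :
    ∑ i, InnerProductSpace.rankOne ℝ (stdOrthonormalBasis ℝ V i : G)
      (Φ.adjoint (stdOrthonormalBasis ℝ V i)) = Φ := by
  ext x
  have h := congrArg (Subtype.val) ((stdOrthonormalBasis ℝ V).sum_repr' ⟨Φ x, hΦ x⟩)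
  simp only [AddSubmonoidClass.coe_finsetSum, Submodule.coe_smul, Submodule.coe_inner] at h
  rw [_root_.sum_apply, ← h]
  refine Finset.sum_congr rfl fun i _ => ?_
  rw [InnerProductSpace.rankOne_apply, ContinuousLinearMap.adjoint_inner_left]

theorem sum_rankOne_comp_adjoint (V : Submodule ℝ G) [FiniteDimensional ℝ V] {Φ : U →L[ℝ] G}
    (hΦ : ∀ x, Φ x ∈ V) (B : G →L[ℝ] K) :
    ∑ i, InnerProductSpace.rankOne ℝ (B (stdOrthonormalBasis ℝ V i : G))
      (Φ.adjoint (stdOrthonormalBasis ℝ V i)) = B ∘L Φ := by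
  nth_rw 2 [← sum_rankOne_adjoint V Φ hΦ]
  ext x
  simp

/-- Bessel's inequality for the adjoint of an operator, in Hilbert-Schmidt form. -/
theorem sum_enorm_adjoint_sq_le (V : Submodule ℝ G) [FiniteDimensional ℝ V] (Φ : U →L[ℝ] G) :
    ∑ i, ‖Φ.adjoint (stdOrthonormalBasis ℝ V i : G)‖ₑ ^ 2 ≤ hsSq Φ := by
  have hP : ∀ w : U, ‖w‖ₑ ^ 2 = ∑' l, ‖inner ℝ (onb U l) w‖ₑ ^ 2 := by
    intro w
    have h := (onb U).hasSum_inner_mul_inner w w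
    have h2 : HasSum (fun l => ‖(inner ℝ (onb U l) w : ℝ)‖ ^ 2) (‖w‖ ^ 2) := by
      rw [← real_inner_self_eq_norm_sq]
      refine h.congr_fun fun l => ?_
      rw [real_inner_comm (onb U l) w, Real.norm_eq_abs, sq_abs, sq]
    rw [← ofReal_norm, ← ENNReal.ofReal_pow (norm_nonneg _), ← h2.tsum_eq,
      ENNReal.ofReal_tsum_of_nonneg (fun i => by positivity) h2.summable]
    refine tsum_congr fun i => ?_
    rw [ENNReal.ofReal_pow (norm_nonneg _), ofReal_norm]
  simp only [hP]
  rw [← tsum_fintype (L := .unconditional _), ENNReal.tsum_comm, hsSq]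
  refine ENNReal.tsum_le_tsum fun l => ?_
  rw [tsum_fintype]
  have hon : Orthonormal ℝ fun i => (stdOrthonormalBasis ℝ V i : G) :=
    (stdOrthonormalBasis ℝ V).orthonormal.comp_linearIsometry V.subtypeₗᵢ
  have h := hon.sum_inner_products_le (Φ (onb U l)) (s := Finset.univ)
  rw [← ofReal_norm, ← ENNReal.ofReal_pow (norm_nonneg _)]
  refine le_trans (le_of_eq ?_) (ENNReal.ofReal_le_ofReal h)
  rw [ENNReal.ofReal_sum_of_nonneg fun i _ => by positivity]
  refine Finset.sum_congr rfl fun i _ => ?_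
  rw [ENNReal.ofReal_pow (norm_nonneg _), ofReal_norm, ContinuousLinearMap.adjoint_inner_right,
    ← enorm_norm, ← enorm_norm (inner ℝ _ (Φ _)), norm_inner_symm]

end HilbertSchmidtLemmas

/-! ### Wiener integrals of elementary integrands -/

section WienerIsometry

variable {Ω : Type*} [MeasurableSpace Ω] {P : Measure Ω}
  {U : Type*} [NormedAddCommGroup U] [InnerProductSpace ℝ U]
  {G : Type*} [NormedAddCommGroup G] [InnerProductSpace ℝ G]
  {T : ℝ} {W : ℝ → U →L[ℝ] Lp ℝ 2 P}

theorem memLp_increment (W : ℝ → U →L[ℝ] Lp ℝ 2 P) (a b : ℝ) (u : U) :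
    MemLp (fun ω => W b u ω - W a u ω) 2 P :=
  (Lp.memLp (W b u)).sub (Lp.memLp (W a u))

/-- The covariance of two increments of a Brownian motion is the length of the overlap. -/
theorem volume_real_Ioc_inter {a b a' b' : ℝ} (h : a ≤ b) (h' : a' ≤ b') :
    min b b' - min b a' - min a b' + min a a' = volume.real (Ioc a b ∩ Ioc a' b') := by
  rw [Ioc_inter_Ioc, Real.volume_real_Ioc]
  rcases le_total b b' with h1 | h1 <;> rcases le_total b a' with h2 | h2 <;>
  rcases le_total a b' with h3 | h3 <;> rcases le_total a a' with h4 | h4 <;>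
  simp only [min_eq_left, min_eq_right, max_eq_left, max_eq_right, h1, h2, h3, h4] <;>
  first
  | rw [max_eq_left (by linarith)]; linarith
  | rw [max_eq_right (by linarith)]; linarith

theorem IsCylindricalWiener.integral_increment_mul (hW : IsCylindricalWiener P T W)
    {a b a' b' : ℝ} (ha : 0 ≤ a) (hab : a ≤ b) (hb : b ≤ T) (ha' : 0 ≤ a') (hab' : a' ≤ b')
    (hb' : b' ≤ T) (u v : U) :
    ∫ ω, (W b u ω - W a u ω) * (W b' v ω - W a' v ω) ∂P =
      volume.real (Ioc a b ∩ Ioc a' b') * inner ℝ u v := by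
  have hi : ∀ s t, Integrable (fun ω => W s u ω * W t v ω) P := fun s t =>
    (Lp.memLp (W s u)).integrable_mul (Lp.memLp (W t v))
  have hmem : a ∈ Icc 0 T ∧ b ∈ Icc 0 T ∧ a' ∈ Icc 0 T ∧ b' ∈ Icc 0 T :=
    ⟨⟨ha, hab.trans hb⟩, ⟨ha.trans hab, hb⟩, ⟨ha', hab'.trans hb'⟩, ⟨ha'.trans hab', hb'⟩⟩
  obtain ⟨h1, h2, h3, h4⟩ := hmem
  have e : ∀ ω, (W b u ω - W a u ω) * (W b' v ω - W a' v ω) =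
      W b u ω * W b' v ω - W b u ω * W a' v ω - W a u ω * W b' v ω + W a u ω * W a' v ω :=
    fun ω => by ring
  simp only [e]
  have i1 : Integrable (fun ω => W b u ω * W b' v ω - W b u ω * W a' v ω) P :=
    (hi _ _).sub (hi _ _)
  have i2 : Integrable (fun ω => W b u ω * W b' v ω - W b u ω * W a' v ω - W a u ω * W b' v ω) P :=
    i1.sub (hi _ _)
  rw [integral_add i2 (hi _ _), integral_sub i1 (hi _ _), integral_sub (hi _ _) (hi _ _),
    hW.covariance u v b h2 b' h4, hW.covariance u v b h2 a' h3, hW.covariance u v a h1 b' h4,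
    hW.covariance u v a h1 a' h3, ← volume_real_Ioc_inter hab hab']
  ring

theorem ElemIntegrand.fn_eq (s : ElemIntegrand T U G) (t : ℝ) :
    s.fn t = ∑ i, (Ioc (s.a i) (s.b i)).indicator (fun _ => (1 : ℝ)) t •
      InnerProductSpace.rankOne ℝ (s.g i) (s.u i) := by
  refine Finset.sum_congr rfl fun i _ => ?_
  by_cases h : t ∈ Ioc (s.a i) (s.b i) <;> simp [h]

theorem ElemIntegrand.memLp_integral (s : ElemIntegrand T U G) (W : ℝ → U →L[ℝ] Lp ℝ 2 P) :
    MemLp (s.integral W) 2 P := by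
  unfold ElemIntegrand.integral
  refine memLp_finsetSum _ fun i _ => ?_
  exact (ContinuousLinearMap.toSpanSingleton ℝ (s.g i)).comp_memLp' (memLp_increment W _ _ _)

/-- The difference of two elementary integrands. -/
def ElemIntegrand.sub (s s' : ElemIntegrand T U G) : ElemIntegrand T U G where
  m := s.m + s'.m
  a := Fin.append s.a s'.a
  b := Fin.append s.b s'.b
  u := Fin.append s.u s'.u
  g := Fin.append s.g fun i => -s'.g i
  nonneg i := by
    refine Fin.addCases (fun i => ?_) (fun i => ?_) i
    · simpa using s.nonneg i
    · simpa using s'.nonneg i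
  le i := by
    refine Fin.addCases (fun i => ?_) (fun i => ?_) i
    · simpa using s.le i
    · simpa using s'.le i
  le_T i := by
    refine Fin.addCases (fun i => ?_) (fun i => ?_) i
    · simpa using s.le_T i
    · simpa using s'.le_T i

theorem ElemIntegrand.fn_sub (s s' : ElemIntegrand T U G) (t : ℝ) :
    (s.sub s').fn t = s.fn t - s'.fn t := by
  change ∑ i : Fin (s.m + s'.m), _ = _
  rw [Fin.sum_univ_add, sub_eq_add_neg, ElemIntegrand.fn, ElemIntegrand.fn, ← Finset.sum_neg_distrib]
  congr 1
  · simp [ElemIntegrand.sub]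
  · refine Finset.sum_congr rfl fun i _ => ?_
    by_cases h : t ∈ Ioc (s'.a i) (s'.b i) <;> simp [ElemIntegrand.sub, h]

theorem ElemIntegrand.integral_sub (s s' : ElemIntegrand T U G) (W : ℝ → U →L[ℝ] Lp ℝ 2 P) :
    (s.sub s').integral W = fun ω => s.integral W ω - s'.integral W ω := by
  ext1 ω
  change ∑ i : Fin (s.m + s'.m), _ = _
  rw [Fin.sum_univ_add, sub_eq_add_neg, ElemIntegrand.integral, ElemIntegrand.integral,
    ← Finset.sum_neg_distrib]
  congr 1
  · simp [ElemIntegrand.sub]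
  · simp [ElemIntegrand.sub]

variable [CompleteSpace U]

/-- The Itô isometry for deterministic elementary integrands. -/
theorem IsCylindricalWiener.eLpNorm_integral_sq (hW : IsCylindricalWiener P T W)
    (s : ElemIntegrand T U G) :
    eLpNorm (s.integral W) 2 P ^ 2 = ∫⁻ t in Icc 0 T, hsSq (s.fn t) := by
  have hind : ∀ i j, (fun t => (Ioc (s.a i) (s.b i)).indicator (fun _ => (1 : ℝ)) t *
      (Ioc (s.a j) (s.b j)).indicator (fun _ => (1 : ℝ)) t) =
      (Ioc (s.a i) (s.b i) ∩ Ioc (s.a j) (s.b j)).indicator fun _ => (1 : ℝ) := by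
    intro i j
    ext t
    by_cases h1 : t ∈ Ioc (s.a i) (s.b i) <;> by_cases h2 : t ∈ Ioc (s.a j) (s.b j) <;>
      simp [indicator, h1, h2]
  have hm : ∀ i j, MeasurableSet (Ioc (s.a i) (s.b i) ∩ Ioc (s.a j) (s.b j)) := fun i j =>
    measurableSet_Ioc.inter measurableSet_Ioc
  have hint : ∀ i j, Integrable (fun t => (Ioc (s.a i) (s.b i)).indicator (fun _ => (1 : ℝ)) t *
      (Ioc (s.a j) (s.b j)).indicator (fun _ => (1 : ℝ)) t) (volume.restrict (Icc 0 T)) := by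
    intro i j
    rw [hind]
    exact (integrable_const _).indicator (hm i j)
  have hval : ∀ i j, ∫ t in Icc 0 T, (Ioc (s.a i) (s.b i)).indicator (fun _ => (1 : ℝ)) t *
      (Ioc (s.a j) (s.b j)).indicator (fun _ => (1 : ℝ)) t =
      volume.real (Ioc (s.a i) (s.b i) ∩ Ioc (s.a j) (s.b j)) := by
    intro i j
    rw [hind, integral_indicator (hm i j), integral_const, smul_eq_mul, mul_one,
      measureReal_restrict_apply_univ, measureReal_restrict_apply (hm i j), inter_eq_left.2]
    exact fun t ht => ⟨(s.nonneg i).trans ht.1.1.le, ht.1.2.trans (s.le_T i)⟩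
  have hR : ∫⁻ t in Icc 0 T, hsSq (s.fn t) = ENNReal.ofReal (∑ i, ∑ j,
      volume.real (Ioc (s.a i) (s.b i) ∩ Ioc (s.a j) (s.b j)) *
        (inner ℝ (s.g i) (s.g j) * inner ℝ (s.u i) (s.u j))) := by
    simp only [ElemIntegrand.fn_eq, hsSq_sum_rankOne]
    rw [← ofReal_integral_eq_lintegral_ofReal]
    · congr 1
      rw [integral_finsetSum _ fun i _ => integrable_finsetSum _ fun j _ =>
        (hint i j).mul_const _]
      refine Finset.sum_congr rfl fun i _ => ?_
      rw [integral_finsetSum _ fun j _ => (hint i j).mul_const _]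
      refine Finset.sum_congr rfl fun j _ => ?_
      rw [integral_mul_const, hval]
    · exact integrable_finsetSum _ fun i _ => integrable_finsetSum _ fun j _ =>
        (hint i j).mul_const _
    · exact Eventually.of_forall fun t =>
        (hasSum_norm_sum_rankOne_sq Finset.univ _ s.g s.u).nonneg fun l => by positivity
  have hpr : ∀ i j, Integrable (fun ω => (W (s.b i) (s.u i) ω - W (s.a i) (s.u i) ω) *
      (W (s.b j) (s.u j) ω - W (s.a j) (s.u j) ω)) P := fun i j =>
    (memLp_increment W _ _ _).integrable_mul (memLp_increment W _ _ _)
  have hL : ∀ ω, ‖s.integral W ω‖ ^ 2 = ∑ i, ∑ j,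
      ((W (s.b i) (s.u i) ω - W (s.a i) (s.u i) ω) *
      (W (s.b j) (s.u j) ω - W (s.a j) (s.u j) ω)) * inner ℝ (s.g i) (s.g j) := by
    intro ω
    rw [← real_inner_self_eq_norm_sq, ElemIntegrand.integral, sum_inner]
    refine Finset.sum_congr rfl fun i _ => ?_
    rw [inner_sum]
    refine Finset.sum_congr rfl fun j _ => ?_
    rw [inner_smul_left, inner_smul_right]
    exact (mul_assoc _ _ _).symm
  have hN : eLpNorm (s.integral W) 2 P ^ 2 = ∫⁻ ω, ENNReal.ofReal (‖s.integral W ω‖ ^ 2) ∂P := by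
    rw [eLpNorm_eq_lintegral_rpow_enorm_toReal two_ne_zero ENNReal.ofNat_ne_top, ← ENNReal.rpow_natCast,
      ← ENNReal.rpow_mul]
    norm_num
  rw [hR, hN, ← ofReal_integral_eq_lintegral_ofReal]
  · congr 1
    simp only [hL]
    rw [integral_finsetSum _ fun i _ => integrable_finsetSum _ fun j _ => (hpr i j).mul_const _]
    refine Finset.sum_congr rfl fun i _ => ?_
    rw [integral_finsetSum _ fun j _ => (hpr i j).mul_const _]
    refine Finset.sum_congr rfl fun j _ => ?_
    rw [integral_mul_const, hW.integral_increment_mul (s.nonneg i) (s.le i) (s.le_T i)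
      (s.nonneg j) (s.le j) (s.le_T j)]
    ring
  · simp only [hL]
    exact integrable_finsetSum _ fun i _ => integrable_finsetSum _ fun j _ => (hpr i j).mul_const _
  · exact Eventually.of_forall fun ω => by positivity

/-- The Wiener integral of an elementary integrand is almost surely the elementary integral. -/
theorem IsWienerIntegral.ae_eq_of_elem (hW : IsCylindricalWiener P T W) {Y : Ω → G}
    (s : ElemIntegrand T U G) (hY : IsWienerIntegral T W s.fn Y) : Y =ᵐ[P] s.integral W := by
  obtain ⟨hYm, r, hr, hYr⟩ := hY
  have h1 : Tendsto (fun m => eLpNorm (fun ω => s.integral W ω - (r m).integral W ω) 2 P)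
      atTop (𝓝 0) := by
    have h2 : Tendsto (fun m => (eLpNorm (fun ω => s.integral W ω - (r m).integral W ω) 2 P ^ 2)
        ^ (1 / 2 : ℝ)) atTop (𝓝 (0 ^ (1 / 2 : ℝ))) := by
      refine Tendsto.ennrpow_const _ (hr.congr fun m => ?_)
      rw [← ElemIntegrand.integral_sub, hW.eLpNorm_integral_sq]
      simp only [ElemIntegrand.fn_sub]
    rw [ENNReal.zero_rpow_of_pos (by norm_num)] at h2
    refine h2.congr fun m => ?_
    rw [← ENNReal.rpow_natCast, ← ENNReal.rpow_mul]
    norm_num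
  have h3 : eLpNorm (Y - s.integral W) 2 P = 0 := by
    refine le_antisymm (ge_of_tendsto (by simpa using hYr.add h1) ?_) (zero_le)
    refine Eventually.of_forall fun m => ?_
    refine le_trans (le_of_eq ?_) (eLpNorm_sub_le
      (hYm.sub ((r m).memLp_integral W).aestronglyMeasurable)
      ((s.memLp_integral W).aestronglyMeasurable.sub ((r m).memLp_integral W).aestronglyMeasurable)
      (by norm_num))
    congr 1
    ext ω
    simp
  rw [eLpNorm_eq_zero_iff (hYm.sub (s.memLp_integral W).aestronglyMeasurable) two_ne_zero] at h3
  exact h3.mono fun ω h => sub_eq_zero.1 h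

theorem isWienerIntegral_elem (s : ElemIntegrand T U G) (W : ℝ → U →L[ℝ] Lp ℝ 2 P)
    {Φ : ℝ → U →L[ℝ] G} (hΦ : ∀ᵐ t ∂volume.restrict (Icc 0 T), Φ t = s.fn t) :
    IsWienerIntegral T W Φ (s.integral W) := by
  refine ⟨(s.memLp_integral W).aestronglyMeasurable, fun _ => s, ?_, ?_⟩
  · have : ∫⁻ t in Icc 0 T, hsSq (Φ t - s.fn t) = 0 := by
      rw [← lintegral_zero (μ := volume.restrict (Icc 0 T))]
      refine lintegral_congr_ae (hΦ.mono fun t ht => ?_)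
      simp [ht, hsSq]
    simp only [this]
    exact tendsto_const_nhds
  · simp

end WienerIsometry

/-! ### Moments of Gaussian sums -/

section Gaussian

variable {Ω : Type*} [MeasurableSpace Ω] {P : Measure Ω}
  {U : Type*} [NormedAddCommGroup U] [InnerProductSpace ℝ U]
  {H : Type*} [NormedAddCommGroup H] [InnerProductSpace ℝ H]
  {T : ℝ} {W : ℝ → U →L[ℝ] Lp ℝ 2 P}

/-- The `L^p` norm of a standard Gaussian random variable. -/
def gaussianMoment (p : ℝ≥0∞) : ℝ≥0∞ := eLpNorm id p (gaussianReal 0 1)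

theorem gaussianMoment_lt_top {p : ℝ≥0∞} (hp : p ≠ ∞) : gaussianMoment p < ∞ :=
  (memLp_id_gaussianReal' p hp).2

theorem eLpNorm_sq_of_map_eq_gaussianReal {z : Ω → ℝ} (hz : AEMeasurable z P) {v : ℝ≥0}
    (h : P.map z = gaussianReal 0 v) (p : ℝ≥0∞) :
    eLpNorm z p P ^ 2 = v * gaussianMoment p ^ 2 := by
  have h1 : eLpNorm z p P = eLpNorm id p (P.map z) :=
    (eLpNorm_map_measure aestronglyMeasurable_id hz).symm
  have h2 : gaussianReal 0 v = (gaussianReal 0 1).map (fun x => Real.sqrt v * x) := by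
    rw [gaussianReal_map_const_mul]
    congr 1
    · simp
    · ext
      simp
  rw [h1, h, h2, eLpNorm_map_measure aestronglyMeasurable_id (by fun_prop)]
  change eLpNorm (fun x => Real.sqrt v • id x) p _ ^ 2 = _
  rw [show (fun x : ℝ => Real.sqrt v • id x) = Real.sqrt v • id from rfl, eLpNorm_const_smul,
    mul_pow, gaussianMoment, ← ofReal_norm, ← ENNReal.ofReal_pow (norm_nonneg _), Real.norm_eq_abs,
    sq_abs, Real.sq_sqrt v.coe_nonneg, ENNReal.ofReal_coe_nnreal]

theorem eLpNorm_sq_eq_eLpNorm_norm_sq {E : Type*} [NormedAddCommGroup E] (f : Ω → E)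
    (p : ℝ≥0∞) : eLpNorm f p P ^ 2 = eLpNorm (fun ω => ‖f ω‖ ^ 2) (p / 2) P := by
  have h := eLpNorm_norm_rpow (p := p / 2) (μ := P) f (q := 2) (by norm_num)
  rw [ENNReal.ofReal_ofNat, ENNReal.div_mul_cancel two_ne_zero ENNReal.ofNat_ne_top] at h
  simpa using h.symm

/-- Minkowski's inequality in `L^{p/2}` for the square of the norm of a finite-dimensional random
vector. -/
theorem eLpNorm_sum_smul_orthonormal_sq_le {ι : Type*} [Fintype ι] {e : ι → H}
    (he : Orthonormal ℝ e) {z : ι → Ω → ℝ} (hz : ∀ i, AEStronglyMeasurable (z i) P) {p : ℝ≥0∞}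
    (hp : 2 ≤ p) :
    eLpNorm (fun ω => ∑ i, z i ω • e i) p P ^ 2 ≤ ∑ i, eLpNorm (z i) p P ^ 2 := by
  have h1 : 1 ≤ p / 2 := by
    rw [ENNReal.le_div_iff_mul_le (by simp) (by simp)]
    simpa using hp
  simp only [eLpNorm_sq_eq_eLpNorm_norm_sq]
  refine le_trans (le_of_eq ?_) (eLpNorm_sum_le (f := fun i ω => ‖z i ω‖ ^ 2) (s := Finset.univ)
    (fun i _ => ((hz i).norm.pow 2)) h1)
  congr 1
  ext ω
  rw [Finset.sum_apply, ← real_inner_self_eq_norm_sq, he.inner_sum]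
  refine Finset.sum_congr rfl fun i _ => ?_
  simp [sq]

/-- A sum of consecutive increments of a cylindrical Wiener process is Gaussian. -/
theorem IsCylindricalWiener.map_sum_increment [IsProbabilityMeasure P]
    (hW : IsCylindricalWiener P T W) {t : ℕ → ℝ}
    (ht : Monotone t) (ht0 : 0 ≤ t 0) (v : ℕ → U) (n : ℕ) (htn : t n ≤ T) :
    P.map (fun ω => ∑ j ∈ Finset.range n, (W (t (j + 1)) (v j) ω - W (t j) (v j) ω)) =
      gaussianReal 0 (∑ j ∈ Finset.range n, Real.toNNReal ((t (j + 1) - t j) * ‖v j‖ ^ 2)) := by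
  induction n with
  | zero => simp [Measure.map_const]
  | succ n ih =>
    have hle : t n ≤ t (n + 1) := ht n.le_succ
    have h0 : ∀ j, 0 ≤ t j := fun j => ht0.trans (ht j.zero_le)
    have hmeas : ∀ r ∈ Icc 0 (t n), ∀ u : U, Measurable[pastSigma P W (t n)] (W r u : Ω → ℝ) :=
      fun r hr u => Measurable.mono (comap_measurable _)
        (le_iSup₂_of_le r hr (le_iSup_of_le u le_rfl)) le_rfl
    have hpast : Measurable[pastSigma P W (t n)]
        (fun ω => ∑ j ∈ Finset.range n, (W (t (j + 1)) (v j) ω - W (t j) (v j) ω)) := by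
      refine Finset.measurable_fun_sum _ fun j hj => ?_
      have hj' := Finset.mem_range.1 hj
      exact (hmeas _ ⟨h0 _, ht hj'⟩ _).sub (hmeas _ ⟨h0 _, ht hj'.le⟩ _)
    have hind : IndepFun (fun ω => ∑ j ∈ Finset.range n, (W (t (j + 1)) (v j) ω - W (t j) (v j) ω))
        (fun ω => W (t (n + 1)) (v n) ω - W (t n) (v n) ω) P :=
      (indep_of_indep_of_le_right (hW.indep (v n) _ _ (h0 n) hle htn) hpast.comap_le).symm
    have h := gaussianReal_add_gaussianReal_of_indepFun hind (ih (hle.trans htn))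
      (hW.gaussian (v n) _ _ (h0 n) hle htn)
    rw [add_zero, ← Finset.sum_range_succ
      (fun j => Real.toNNReal ((t (j + 1) - t j) * ‖v j‖ ^ 2))] at h
    rw [← h]
    congr 1
    ext ω
    rw [Finset.sum_range_succ]
    rfl

variable [CompleteSpace U] [CompleteSpace H] (V : Submodule ℝ H) [FiniteDimensional ℝ V]

/-- The Wiener integral `∫ₐᵇ Φ dW` of an operator `Φ` with values in the finite-dimensional space
`V`, written in the coordinates of an orthonormal basis of `V`. -/
def blockIncrement (W : ℝ → U →L[ℝ] Lp ℝ 2 P) (Φ : U →L[ℝ] H) (a b : ℝ) (ω : Ω) : H :=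
  ∑ i, (W b (Φ.adjoint (stdOrthonormalBasis ℝ V i)) ω -
    W a (Φ.adjoint (stdOrthonormalBasis ℝ V i)) ω) • (stdOrthonormalBasis ℝ V i : H)

/-- The elementary integrand `1_{(a, b]} Φ` for an operator `Φ` with values in `V`, followed by the
operator `B`. -/
def blockIntegrand (T : ℝ) (Φ : U →L[ℝ] H) (B : H →L[ℝ] H) {a b : ℝ} (ha : 0 ≤ a) (hab : a ≤ b)
    (hb : b ≤ T) : ElemIntegrand T U H where
  m := Module.finrank ℝ V
  a _ := a
  b _ := b
  u i := Φ.adjoint (stdOrthonormalBasis ℝ V i)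
  g i := B (stdOrthonormalBasis ℝ V i)
  nonneg _ := ha
  le _ := hab
  le_T _ := hb

variable {V}

theorem blockIntegrand_fn {Φ : U →L[ℝ] H} (hΦ : ∀ x, Φ x ∈ V) (B : H →L[ℝ] H) {a b : ℝ}
    (ha : 0 ≤ a) (hab : a ≤ b) (hb : b ≤ T) :
    (blockIntegrand V T Φ B ha hab hb).fn = (Ioc a b).indicator fun _ => B ∘L Φ := by
  ext1 t
  by_cases ht : t ∈ Ioc a b
  · rw [indicator_of_mem ht, ← sum_rankOne_comp_adjoint V hΦ]
    exact Finset.sum_congr rfl fun i _ => indicator_of_mem ht _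
  · rw [indicator_of_notMem ht]
    exact Finset.sum_eq_zero fun i _ => indicator_of_notMem ht _

theorem blockIntegrand_integral (Φ : U →L[ℝ] H) (B : H →L[ℝ] H) {a b : ℝ}
    (ha : 0 ≤ a) (hab : a ≤ b) (hb : b ≤ T) (ω : Ω) :
    (blockIntegrand V T Φ B ha hab hb).integral W ω = B (blockIncrement V W Φ a b ω) := by
  simp only [ElemIntegrand.integral, blockIntegrand, blockIncrement, map_sum, map_smul]
  rfl

theorem IsWienerIntegral.ae_eq_blockIncrement (hW : IsCylindricalWiener P T W)
    {Φ : U →L[ℝ] H} (hΦ : ∀ x, Φ x ∈ V) {a b : ℝ} (ha : 0 ≤ a) (hab : a ≤ b) (hb : b ≤ T)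
    {Y : Ω → H} (hY : IsWienerIntegral T W ((Ioc a b).indicator fun _ => Φ) Y) :
    Y =ᵐ[P] blockIncrement V W Φ a b := by
  have h := blockIntegrand_fn (T := T) hΦ (ContinuousLinearMap.id ℝ H) ha hab hb
  rw [ContinuousLinearMap.id_comp] at h
  rw [← h] at hY
  filter_upwards [hY.ae_eq_of_elem hW] with ω hω
  rw [hω, blockIntegrand_integral]
  rfl

/-- Both sides are elementary integrals of the same integrand, in different coordinates; by the Itô
isometry they agree almost surely. -/
theorem IsCylindricalWiener.blockIncrement_comp (hW : IsCylindricalWiener P T W)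
    {Φ : U →L[ℝ] H} (hΦ : ∀ x, Φ x ∈ V) {B : H →L[ℝ] H} (hB : ∀ x, B (Φ x) ∈ V) {a b : ℝ}
    (ha : 0 ≤ a) (hab : a ≤ b) (hb : b ≤ T) :
    ∀ᵐ ω ∂P, B (blockIncrement V W Φ a b ω) = blockIncrement V W (B ∘L Φ) a b ω := by
  have h := isWienerIntegral_elem (blockIntegrand V T Φ B ha hab hb) W
    (Φ := (Ioc a b).indicator fun _ => B ∘L Φ)
    (Eventually.of_forall fun t => by rw [blockIntegrand_fn hΦ])
  filter_upwards [h.ae_eq_blockIncrement hW hB ha hab hb] with ω hω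
  rw [← hω, blockIntegrand_integral]

/-- The moments of `∑ⱼ ∫ Φⱼ dW`, the integrals being over consecutive intervals. -/
theorem IsCylindricalWiener.eLpNorm_sum_blockIncrement_sq_le [IsProbabilityMeasure P]
    (hW : IsCylindricalWiener P T W) {t : ℕ → ℝ} (ht : Monotone t) (ht0 : 0 ≤ t 0)
    (Φ : ℕ → U →L[ℝ] H) (n : ℕ) (htn : t n ≤ T) {p : ℝ≥0∞} (hp : 2 ≤ p) :
    eLpNorm (fun ω => ∑ j ∈ Finset.range n, blockIncrement V W (Φ j) (t j) (t (j + 1)) ω) p P ^ 2 ≤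
      gaussianMoment p ^ 2 *
        ∑ j ∈ Finset.range n, ENNReal.ofReal (t (j + 1) - t j) * hsSq (Φ j) := by
  set e := stdOrthonormalBasis ℝ V
  have hon : Orthonormal ℝ fun i => (e i : H) := e.orthonormal.comp_linearIsometry V.subtypeₗᵢ
  let z : Fin (Module.finrank ℝ V) → Ω → ℝ := fun i ω => ∑ j ∈ Finset.range n,
    (W (t (j + 1)) ((Φ j).adjoint (e i)) ω - W (t j) ((Φ j).adjoint (e i)) ω)
  have hz : ∀ i, AEStronglyMeasurable (z i) P := fun i =>
    Finset.aestronglyMeasurable_fun_sum _ fun j _ => (memLp_increment W _ _ _).aestronglyMeasurable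
  have hsum : (fun ω => ∑ j ∈ Finset.range n, blockIncrement V W (Φ j) (t j) (t (j + 1)) ω) =
      fun ω => ∑ i, z i ω • (e i : H) := by
    ext ω
    simp only [blockIncrement, z, Finset.sum_smul]
    exact Finset.sum_comm
  rw [hsum]
  refine (eLpNorm_sum_smul_orthonormal_sq_le hon hz hp).trans ?_
  have hzi : ∀ i, eLpNorm (z i) p P ^ 2 = (∑ j ∈ Finset.range n,
      ENNReal.ofReal (t (j + 1) - t j) * ‖(Φ j).adjoint (e i : H)‖ₑ ^ 2) * gaussianMoment p ^ 2 := by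
    intro i
    rw [eLpNorm_sq_of_map_eq_gaussianReal (hz i).aemeasurable
      (hW.map_sum_increment ht ht0 (fun j => (Φ j).adjoint (e i)) n htn)]
    congr 1
    push_cast
    refine Finset.sum_congr rfl fun j _ => ?_
    change ENNReal.ofReal _ = _
    rw [ENNReal.ofReal_mul (sub_nonneg.2 (ht j.le_succ)), ENNReal.ofReal_pow (norm_nonneg _),
      ofReal_norm]
  simp only [hzi]
  rw [← Finset.sum_mul, mul_comm, Finset.sum_comm]
  gcongr with j
  rw [← Finset.mul_sum]
  gcongr
  exact sum_enorm_adjoint_sq_le V (Φ j)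

end Gaussian

/-! ### Discrete Gronwall inequality and singular sums -/

section Discrete

theorem add_mul_sum_pow (K c : ℝ≥0∞) (n : ℕ) :
    K + c * ∑ j ∈ Finset.range n, K * (1 + c) ^ j = K * (1 + c) ^ n := by
  induction n with
  | zero => simp
  | succ n ih =>
    rw [Finset.sum_range_succ, mul_add, ← add_assoc, ih]
    ring

/-- The discrete Gronwall inequality in summed form. -/
theorem le_mul_pow_of_le_add_mul_sum {K c : ℝ≥0∞} {a : ℕ → ℝ≥0∞} {N : ℕ}
    (h : ∀ n ≤ N, a n ≤ K + c * ∑ j ∈ Finset.range n, a j) :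
    ∀ n ≤ N, a n ≤ K * (1 + c) ^ n := by
  intro n
  induction n using Nat.strong_induction_on with
  | _ n ih =>
    intro hn
    refine (h n hn).trans ?_
    rw [← add_mul_sum_pow]
    gcongr with j hj
    have hj' := Finset.mem_range.1 hj
    exact ih j hj' (hj'.le.trans hn)

theorem one_add_ofReal_pow_le {x y : ℝ} (hx : 0 ≤ x) {n : ℕ} (h : n * x ≤ y) :
    (1 + ENNReal.ofReal x) ^ n ≤ ENNReal.ofReal (Real.exp y) := by
  rw [← ENNReal.ofReal_one, ← ENNReal.ofReal_add zero_le_one hx,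
    ← ENNReal.ofReal_pow (by positivity)]
  refine ENNReal.ofReal_le_ofReal ?_
  calc (1 + x) ^ n ≤ Real.exp x ^ n := by
        gcongr
        linarith [Real.add_one_le_exp x]
    _ = Real.exp (n * x) := (Real.exp_nat_mul x n).symm
    _ ≤ Real.exp y := Real.exp_le_exp.2 h

/-- The discrete variation of constants formula. -/
theorem eq_pow_add_sum_of_recursion {E : Type*} [AddCommGroup E] [Module ℝ E]
    [TopologicalSpace E] [IsTopologicalAddGroup E] [ContinuousConstSMul ℝ E]
    (S : E →L[ℝ] E) {a b : ℕ → E} {N : ℕ} (h : ∀ n < N, a (n + 1) = S (a n) + b n) :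
    ∀ n ≤ N, a n = (S ^ n) (a 0) + ∑ j ∈ Finset.range n, (S ^ (n - 1 - j)) (b j) := by
  intro n
  induction n with
  | zero => simp
  | succ n ih =>
    intro hn
    rw [h n hn, ih (Nat.le_of_succ_le hn), map_add, map_sum, Finset.sum_range_succ, pow_succ' S n]
    simp only [Nat.add_sub_cancel, Nat.sub_self, pow_zero, one_apply_eq_self,
      mul_apply_eq_comp, add_assoc]
    congr 2
    refine Finset.sum_congr rfl fun j hj => ?_
    have hj' := Finset.mem_range.1 hj
    rw [← mul_apply_eq_comp, ← pow_succ']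
    congr 2
    omega

/-- Comparison of the sum of `m ^ (-δ)` with its integral. -/
theorem sum_rpow_neg_le {δ : ℝ} (h0 : 0 ≤ δ) (h1 : δ < 1) (n : ℕ) :
    ∑ m ∈ Finset.range n, ((m : ℝ) + 1) ^ (-δ) ≤ (n : ℝ) ^ (1 - δ) / (1 - δ) := by
  have hδ : 0 < 1 - δ := by linarith
  induction n with
  | zero => simp [Real.zero_rpow hδ.ne']
  | succ n ih =>
    rw [Finset.sum_range_succ]
    have hn : (0 : ℝ) < n + 1 := by positivity
    -- Bernoulli's inequality, applied to `n / (n + 1) = 1 - 1 / (n + 1)`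
    have hb := rpow_one_add_le_one_add_mul_self (s := -((n : ℝ) + 1)⁻¹)
      (by rw [neg_le_neg_iff]; exact inv_le_one_of_one_le₀ (by simp)) hδ.le (by linarith)
    have he : 1 + -((n : ℝ) + 1)⁻¹ = n / (n + 1) := by
      field_simp
      ring
    rw [he, Real.div_rpow n.cast_nonneg hn.le, div_le_iff₀ (by positivity)] at hb
    have hs : ((n : ℝ) + 1) ^ (1 - δ) = ((n : ℝ) + 1) ^ (-δ) * (n + 1) := by
      rw [sub_eq_neg_add, Real.rpow_add hn, Real.rpow_one]
    have hb' : (n : ℝ) ^ (1 - δ) ≤ ((n : ℝ) + 1) ^ (1 - δ) - (1 - δ) * ((n : ℝ) + 1) ^ (-δ) := by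
      refine hb.trans (le_of_eq ?_)
      rw [hs]
      field_simp
      ring
    push_cast
    rw [le_div_iff₀ hδ] at ih ⊢
    linarith [add_mul (∑ m ∈ Finset.range n, ((m : ℝ) + 1) ^ (-δ)) (((n : ℝ) + 1) ^ (-δ)) (1 - δ)]

theorem mul_sum_rpow_neg_le {δ T k : ℝ} (h0 : 0 ≤ δ) (h1 : δ < 1) (hk : 0 < k) {n : ℕ}
    (hn : n * k ≤ T) :
    ∑ j ∈ Finset.range n, k * (((n - j : ℕ) : ℝ) * k) ^ (-δ) ≤ T ^ (1 - δ) / (1 - δ) := by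
  have hδ : 0 < 1 - δ := by linarith
  rw [← Finset.sum_range_reflect]
  calc ∑ j ∈ Finset.range n, k * (((n - (n - 1 - j) : ℕ) : ℝ) * k) ^ (-δ)
      = ∑ j ∈ Finset.range n, k ^ (1 - δ) * ((j : ℝ) + 1) ^ (-δ) := by
        refine Finset.sum_congr rfl fun j hj => ?_
        have hj' := Finset.mem_range.1 hj
        rw [show n - (n - 1 - j) = j + 1 by omega, Real.mul_rpow (by positivity) hk.le,
          sub_eq_neg_add, Real.rpow_add hk, Real.rpow_one]
        push_cast
        ring
    _ ≤ k ^ (1 - δ) * ((n : ℝ) ^ (1 - δ) / (1 - δ)) := by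
        rw [← Finset.mul_sum]
        gcongr
        exact sum_rpow_neg_le h0 h1 n
    _ = ((n : ℝ) * k) ^ (1 - δ) / (1 - δ) := by
        rw [Real.mul_rpow (by positivity) hk.le]
        ring
    _ ≤ T ^ (1 - δ) / (1 - δ) := by gcongr

variable {E : Type*} [NormedAddCommGroup E]

/-- The intervals are disjoint, so that a step function takes at each point the value `0` or one of
the prescribed values. -/
theorem sum_indicator_Ioc_eq {t : ℕ → ℝ} (ht : Monotone t) (c : ℕ → E) (n : ℕ) (x : ℝ) :
    (∑ j ∈ Finset.range n, (Ioc (t j) (t (j + 1))).indicator (fun _ => c j) x = 0) ∨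
      ∃ j < n, x ∈ Ioc (t j) (t (j + 1)) ∧
        ∑ j ∈ Finset.range n, (Ioc (t j) (t (j + 1))).indicator (fun _ => c j) x = c j := by
  by_cases h : ∃ j < n, x ∈ Ioc (t j) (t (j + 1))
  · obtain ⟨j, hj, hx⟩ := h
    refine Or.inr ⟨j, hj, hx, ?_⟩
    rw [Finset.sum_eq_single_of_mem j (Finset.mem_range.2 hj), indicator_of_mem hx]
    intro i _ hij
    exact indicator_of_notMem
      (fun hi => (disjoint_left.1 (ht.pairwise_disjoint_on_Ioc_succ hij)) hi hx) _
  · refine Or.inl (Finset.sum_eq_zero fun j hj => indicator_of_notMem (fun hx => h ⟨j, ?_, hx⟩) _)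
    exact Finset.mem_range.1 hj

theorem lintegral_enorm_sum_indicator_Ioc_le {t : ℕ → ℝ} (ht : Monotone t) (c : ℕ → E) (n : ℕ)
    {r : ℝ} (hr : 0 < r) (s : Set ℝ) :
    ∫⁻ x in s, ‖∑ j ∈ Finset.range n, (Ioc (t j) (t (j + 1))).indicator (fun _ => c j) x‖ₑ ^ r ≤
      ∑ j ∈ Finset.range n, ENNReal.ofReal (t (j + 1) - t j) * ‖c j‖ₑ ^ r := by
  calc ∫⁻ x in s, ‖∑ j ∈ Finset.range n, (Ioc (t j) (t (j + 1))).indicator (fun _ => c j) x‖ₑ ^ r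
      ≤ ∫⁻ x, ∑ j ∈ Finset.range n,
          (Ioc (t j) (t (j + 1))).indicator (fun _ => ‖c j‖ₑ ^ r) x := by
        refine (setLIntegral_le_lintegral _ _).trans (lintegral_mono fun x => ?_)
        rcases sum_indicator_Ioc_eq ht c n x with h | ⟨j, hj, hx, h⟩
        · rw [h]
          simp [hr]
        · rw [h]
          refine le_trans (le_of_eq ?_) (Finset.single_le_sum (fun _ _ => zero_le)
            (Finset.mem_range.2 hj))
          rw [indicator_of_mem hx]
    _ = ∑ j ∈ Finset.range n, ENNReal.ofReal (t (j + 1) - t j) * ‖c j‖ₑ ^ r := by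
        rw [lintegral_finsetSum _ fun j _ => measurable_const.indicator measurableSet_Ioc]
        refine Finset.sum_congr rfl fun j _ => ?_
        rw [lintegral_indicator measurableSet_Ioc, lintegral_const, Measure.restrict_apply_univ,
          Real.volume_Ioc, mul_comm]

/-- `L^q` bound, uniform in the step size `k`, of a step function whose value on the `j`-th of `n`
intervals is at most `M ((n - j) k)^{-γ}`. -/
theorem exists_eLpNorm_step_le (E : Type*) [NormedAddCommGroup E] {T γ : ℝ} {q : ℝ≥0∞} (M : ℝ)
    (hM : 0 ≤ M) (hγ : 0 ≤ γ) (hq0 : q ≠ 0) (hq : 0 < γ → q < ENNReal.ofReal (1 / γ)) :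
    ∃ K : ℝ≥0, ∀ k : ℝ, 0 < k → ∀ n : ℕ, n * k ≤ T → ∀ c : ℕ → E,
      (∀ j < n, ‖c j‖ ≤ M * (((n - j : ℕ) : ℝ) * k) ^ (-γ)) →
      eLpNorm (fun x => ∑ j ∈ Finset.range n,
        (Ioc (j * k) ((j + 1 : ℕ) * k)).indicator (fun _ => c j) x) q
        (volume.restrict (Icc 0 T)) ≤ K := by
  have hmono : ∀ k : ℝ, 0 < k → Monotone fun j : ℕ => (j : ℝ) * k := fun k hk i j hij => by
    dsimp only
    gcongr
  by_cases hqt : q = ∞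
  -- `q = ∞` is possible only for `γ = 0`, where there is no singularity
  · have hγ0 : γ = 0 := by
      by_contra h
      have := hq (lt_of_le_of_ne hγ (Ne.symm h))
      rw [hqt] at this
      exact absurd this (by simp)
    refine ⟨M.toNNReal, fun k hk n hn c hc => ?_⟩
    rw [hqt, eLpNorm_exponent_top]
    refine eLpNormEssSup_le_of_ae_enorm_bound (Eventually.of_forall fun x => ?_)
    rcases sum_indicator_Ioc_eq (hmono k hk) c n x with h | ⟨j, hj, -, h⟩
    · rw [h]
      simp
    · rw [h]
      have := hc j hj
      rw [hγ0, neg_zero, Real.rpow_zero, mul_one] at this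
      rw [← ofReal_norm]
      exact ENNReal.ofReal_le_ofReal this
  · set r := q.toReal with hr_def
    have hr : 0 < r := ENNReal.toReal_pos hq0 hqt
    have hδ : γ * r < 1 := by
      rcases hγ.eq_or_lt with h | h
      · rw [← h]
        simp
      · have h2 := hq h
        rw [← ENNReal.ofReal_toReal hqt, ENNReal.ofReal_lt_ofReal_iff (by positivity),
          lt_div_iff₀ h] at h2
        linarith [mul_comm γ r]
    have hδ0 : 0 ≤ γ * r := by positivity
    refine ⟨(M ^ r * (T ^ (1 - γ * r) / (1 - γ * r))).toNNReal ^ (1 / r), fun k hk n hn c hc => ?_⟩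
    rw [eLpNorm_eq_lintegral_rpow_enorm_toReal hq0 hqt, ← hr_def,
      ENNReal.coe_rpow_of_nonneg _ (by positivity)]
    gcongr
    refine (lintegral_enorm_sum_indicator_Ioc_le (hmono k hk) c n hr _).trans ?_
    change _ ≤ ENNReal.ofReal _
    calc ∑ j ∈ Finset.range n, ENNReal.ofReal (((j + 1 : ℕ) : ℝ) * k - j * k) * ‖c j‖ₑ ^ r
        ≤ ∑ j ∈ Finset.range n,
            ENNReal.ofReal (M ^ r * (k * (((n - j : ℕ) : ℝ) * k) ^ (-(γ * r)))) := by
          refine Finset.sum_le_sum fun j hj => ?_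
          have hj' := hc j (Finset.mem_range.1 hj)
          have hnn : 0 ≤ ((n - j : ℕ) : ℝ) * k := by positivity
          rw [← ofReal_norm, ENNReal.ofReal_rpow_of_nonneg (norm_nonneg _) hr.le,
            ← ENNReal.ofReal_mul (by push_cast; linarith)]
          refine ENNReal.ofReal_le_ofReal ?_
          calc (((j + 1 : ℕ) : ℝ) * k - j * k) * ‖c j‖ ^ r
              = k * ‖c j‖ ^ r := by push_cast; ring
            _ ≤ k * (M * (((n - j : ℕ) : ℝ) * k) ^ (-γ)) ^ r := by gcongr
            _ = M ^ r * (k * (((n - j : ℕ) : ℝ) * k) ^ (-(γ * r))) := by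
                rw [Real.mul_rpow hM (by positivity), ← Real.rpow_mul hnn, neg_mul]
                ring
      _ = ENNReal.ofReal (M ^ r *
            ∑ j ∈ Finset.range n, k * (((n - j : ℕ) : ℝ) * k) ^ (-(γ * r))) := by
          rw [Finset.mul_sum, ENNReal.ofReal_sum_of_nonneg fun j _ => by positivity]
      _ ≤ _ := by
          gcongr
          exact mul_sum_rpow_neg_le hδ0 hδ hk hn

end Discrete

/-! ### Gâteaux differentiable maps on finite-dimensional spaces -/

section GateauxLemmas

variable {E E' : Type*} [NormedAddCommGroup E] [NormedSpace ℝ E] [NormedAddCommGroup E']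
  [NormedSpace ℝ E']

/-- `D` is the Gâteaux derivative of `f`, and it is strongly continuous. -/
structure IsGateauxDeriv (f : E → E') (D : E → E →L[ℝ] E') : Prop where
  tendsto : ∀ x u, Tendsto (fun ε : ℝ => ε⁻¹ • (f (x + ε • u) - f x)) (𝓝[≠] 0) (𝓝 (D x u))
  continuous : ∀ u, Continuous fun x => D x u

variable {f : E → E'} {D : E → E →L[ℝ] E'}

theorem IsGateauxDeriv.hasDerivAt (h : IsGateauxDeriv f D) (x u : E) (t : ℝ) :
    HasDerivAt (fun t : ℝ => f (x + t • u)) (D (x + t • u) u) t := by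
  rw [hasDerivAt_iff_tendsto_slope_zero]
  refine (h.tendsto (x + t • u) u).congr fun ε => ?_
  rw [add_smul, add_assoc]

theorem IsGateauxDeriv.norm_le (h : IsGateauxDeriv f D) {L : ℝ} (hL : ∀ x, ‖D x‖ ≤ L) (x : E) :
    ‖f x‖ ≤ ‖f 0‖ + L * ‖x‖ := by
  have h1 := norm_image_sub_le_of_norm_deriv_le_segment_01'
    (fun t _ => (h.hasDerivAt 0 x t).hasDerivWithinAt) (C := L * ‖x‖)
    (fun t _ => ((D _).le_opNorm x).trans (by gcongr; exact hL _))
  simp only [one_smul, zero_smul, zero_add] at h1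
  have h2 := norm_le_norm_add_norm_sub' (f x) (f 0)
  linarith

/-- In finite dimensions, strong continuity of the Gâteaux derivative is norm continuity, so that
the map is continuously differentiable. -/
theorem IsGateauxDeriv.hasFDerivAt [FiniteDimensional ℝ E] (h : IsGateauxDeriv f D) (x : E) :
    HasFDerivAt f (D x) x := by
  have hD : Continuous D := continuous_clm_apply.2 h.continuous
  rw [hasFDerivAt_iff_isLittleO_nhds_zero, Asymptotics.isLittleO_iff]
  intro c hc
  obtain ⟨δ, hδ, hball⟩ := Metric.continuousAt_iff.1 (hD.continuousAt (x := x)) c hc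
  filter_upwards [Metric.ball_mem_nhds (0 : E) hδ] with v hv
  have hd : ∀ t ∈ Icc (0 : ℝ) 1, HasDerivWithinAt (fun t : ℝ => f (x + t • v) - t • D x v)
      (D (x + t • v) v - D x v) (Icc 0 1) t := fun t _ => by
    have := (h.hasDerivAt x v t).sub ((hasDerivAt_id t).smul_const (D x v))
    rw [one_smul] at this
    exact this.hasDerivWithinAt
  have h1 := norm_image_sub_le_of_norm_deriv_le_segment_01' hd (C := c * ‖v‖) fun t ht => by
    rw [← _root_.sub_apply]
    refine ((D (x + t • v) - D x).le_opNorm v).trans ?_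
    gcongr
    rw [← dist_eq_norm]
    refine (hball ?_).le
    rw [dist_eq_norm, add_sub_cancel_left, norm_smul, Real.norm_of_nonneg ht.1]
    rw [mem_ball_zero_iff] at hv
    nlinarith [norm_nonneg v, ht.2]
  simp only [one_smul, zero_smul, add_zero, sub_zero] at h1
  rwa [sub_right_comm] at h1

theorem IsGateauxDeriv.contDiff [FiniteDimensional ℝ E] (h : IsGateauxDeriv f D) :
    ContDiff ℝ 1 f := by
  rw [contDiff_one_iff_fderiv]
  refine ⟨fun x => (h.hasFDerivAt x).differentiableAt, ?_⟩
  rw [funext fun x => (h.hasFDerivAt x).fderiv]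
  exact continuous_clm_apply.2 h.continuous

theorem IsGateauxDeriv.comp_clm {E'' : Type*} [NormedAddCommGroup E''] [NormedSpace ℝ E'']
    (h : IsGateauxDeriv f D) (L : E'' →L[ℝ] E) :
    IsGateauxDeriv (fun x => f (L x)) fun x => D (L x) ∘L L where
  tendsto x u := by
    refine (h.tendsto (L x) (L u)).congr fun ε => ?_
    rw [map_add, map_smul]
  continuous u := (h.continuous (L u)).comp L.continuous

theorem MemGb.exists_isGateauxDeriv (h : MemGb 1 f) :
    ∃ D : E → E →L[ℝ] E', IsGateauxDeriv f D ∧ ∃ L : ℝ≥0, ∀ x, ‖D x‖ ≤ L := by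
  obtain ⟨-, D, h0, h1, h2⟩ := h
  obtain ⟨-, hc, L, hL⟩ := h2 1 le_rfl le_rfl
  refine ⟨fun x => continuousMultilinearCurryFin1 ℝ E E' (D 1 x), ⟨fun x u => ?_, fun u => ?_⟩,
    L.toNNReal, fun x => ?_⟩
  · have := h1 0 zero_lt_one x (fun _ => u)
    simp only [h0] at this
    rw [continuousMultilinearCurryFin1_apply]
    convert this using 3
    ext i
    fin_cases i
    rfl
  · simp only [continuousMultilinearCurryFin1_apply]
    exact hc _
  · rw [LinearIsometryEquiv.norm_map]
    exact (hL x).trans (Real.le_coe_toNNReal L)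

end GateauxLemmas

/-! ### Smoothing estimates for the discrete semigroup -/

section Commutation

variable {E : Type*} [NormedAddCommGroup E] [NormedSpace ℝ E]

theorem commute_ringInverse {M : Type*} [MonoidWithZero M] {a b : M}
    (h : Commute a b) : Commute (Ring.inverse a) b := by
  by_cases ha : IsUnit a
  · obtain ⟨u, rfl⟩ := ha
    rw [Ring.inverse_unit]
    exact h.units_inv_left
  · rw [Ring.inverse_non_unit _ ha]
    exact Commute.zero_left b

variable [FiniteDimensional ℝ E] {A : E →ₗ[ℝ] E} {B : E →L[ℝ] E}

theorem commute_shiftInverse (h : Commute B (LinearMap.toContinuousLinearMap A)) (l : ℝ) :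
    Commute B (shiftInverse (A.toPMap ⊤) l) := by
  rw [shiftInverse]
  split_ifs with hex
  · obtain ⟨hR1, hR2⟩ := hex.choose_spec
    set R := hex.choose
    have h1 : ∀ x, l • R x + A (R x) = x := fun x => (hR1 x).choose_spec
    have h2 : ∀ x, R (l • x + A x) = x := fun x => hR2 ⟨x, trivial⟩
    have hBA : ∀ x, B (A x) = A (B x) := fun x => congrArg (fun L : E →L[ℝ] E => L x) h.eq
    ext x
    change B (R x) = R (B x)
    rw [← h2 (B (R x)), ← hBA, ← map_smul, ← map_add, h1]
  · exact Commute.zero_right B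

/-- An operator that commutes with `A` commutes with the negative powers of `A`. -/
theorem commute_negPow (h : Commute B (LinearMap.toContinuousLinearMap A)) (α : ℝ) :
    Commute B (negPow (A.toPMap ⊤) α) := by
  have hI : ∀ f : ℝ → E →L[ℝ] E, (∀ t, Commute B (f t)) → Commute B (∫ t in Ioi (0 : ℝ), f t) := by
    intro f hf
    by_cases hint : Integrable f (volume.restrict (Ioi (0 : ℝ)))
    · have h1 := (ContinuousLinearMap.mul ℝ (E →L[ℝ] E) B).integral_comp_comm hint
      have h2 := ((ContinuousLinearMap.mul ℝ (E →L[ℝ] E)).flip B).integral_comp_comm hint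
      simp only [ContinuousLinearMap.mul_apply', ContinuousLinearMap.flip_apply] at h1 h2
      rw [Commute, SemiconjBy, ← h1, ← h2]
      exact integral_congr_ae (Eventually.of_forall fun t => (hf t).eq)
    · rw [integral_undef hint]
      exact Commute.zero_right B
  rw [negPow]
  refine ((commute_shiftInverse h 0).pow_right _).mul_right ?_
  split_ifs
  · exact Commute.one_right B
  · exact (hI _ fun t => (commute_shiftInverse h t).smul_right _).smul_right _

end Commutation

section SchemeOperator

variable {H : Type*} [NormedAddCommGroup H] [InnerProductSpace ℝ H]
  (V : Ioc (0 : ℝ) 1 → Submodule ℝ H) [∀ h, FiniteDimensional ℝ (V h)]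
  (Ah : ∀ h, V h →ₗ[ℝ] V h)

/-- `(I + k A_h)⁻¹ P_h` as an operator with values in `V_h`. -/
def schemeOpV (h : Ioc (0 : ℝ) 1) (k : ℝ) : H →L[ℝ] V h :=
  Ring.inverse (1 + k • LinearMap.toContinuousLinearMap (Ah h)) ∘L
    (V h).orthogonalProjectionOnto

variable {V Ah} {h : Ioc (0 : ℝ) 1} {k : ℝ}

theorem coe_schemeOpV (x : H) : (schemeOpV V Ah h k x : H) = schemeOp V Ah h k x := rfl

theorem schemeOp_mem (x : H) : schemeOp V Ah h k x ∈ V h := (schemeOpV V Ah h k x).2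

theorem schemeOp_pow_coe (m : ℕ) (v : V h) : (schemeOp V Ah h k ^ m) v =
    ((Ring.inverse (1 + k • LinearMap.toContinuousLinearMap (Ah h)) ^ m : V h →L[ℝ] V h) v : H) := by
  induction m with
  | zero => rfl
  | succ m ih =>
    rw [pow_succ', pow_succ', mul_apply_eq_comp, ih]
    simp [schemeOp]

theorem schemeOp_pow_eq {m : ℕ} (hm : 1 ≤ m) (x : H) : (schemeOp V Ah h k ^ m) x =
    ((Ring.inverse (1 + k • LinearMap.toContinuousLinearMap (Ah h)) ^ m : V h →L[ℝ] V h)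
      ((V h).orthogonalProjectionOnto x) : H) := by
  obtain ⟨m, rfl⟩ := Nat.exists_eq_add_of_le' hm
  rw [← schemeOp_pow_coe, pow_succ, mul_apply_eq_comp, mul_apply_eq_comp]
  congr 1
  rw [← coe_schemeOpV, ← coe_schemeOpV]
  simp only [schemeOpV, ContinuousLinearMap.comp_apply,
    Submodule.orthogonalProjectionOnto_mem_subspace_eq_self]

theorem schemeOp_pow_mem (m : ℕ) {x : H} (hx : x ∈ V h) : (schemeOp V Ah h k ^ m) x ∈ V h := by
  rw [schemeOp_pow_coe m ⟨x, hx⟩]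
  exact Submodule.coe_mem _

variable {T : ℝ} {A : H →ₗ.[ℝ] H} {S : ℝ → H →L[ℝ] H}

/-- Combination of the smoothing property of the scheme with the comparison of the fractional powers
of `A` and `A_h`: `‖S_{h,k}^m x‖ ≤ C t_m^{-γ} ‖A^{-γ} x‖`. -/
theorem SchemeAssumptions.exists_norm_pow_apply_le (hV : SchemeAssumptions V Ah T A S) {γ : ℝ}
    (h0 : 0 ≤ γ) (h1 : γ ≤ 1 / 2) :
    ∃ C : ℝ, 0 ≤ C ∧ ∀ h, ∀ k ∈ Ioc (0 : ℝ) 1, ∀ m : ℕ, 1 ≤ m → m ≤ numSteps T k → ∀ x : H,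
      ‖(schemeOp V Ah h k ^ m) x‖ ≤ C * (m * k) ^ (-γ) * ‖negPow A γ x‖ := by
  obtain ⟨C₁, hC₁⟩ := hV.smoothing γ h0 h1
  obtain ⟨C₂, hC₂⟩ := hV.compat γ h0 h1
  refine ⟨|C₁| * |C₂|, by positivity, fun h k hk m hm hmN x => ?_⟩
  set B := Ring.inverse (1 + k • LinearMap.toContinuousLinearMap (Ah h))
  have hB : Commute (B ^ m) (LinearMap.toContinuousLinearMap (Ah h)) :=
    (commute_ringInverse ((Commute.one_left _).add_left
      ((Commute.refl _).smul_left k))).pow_left m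
  set w := negPow ((Ah h).toPMap ⊤) γ ((V h).orthogonalProjectionOnto x)
  have hz : IsFracPow ((Ah h).toPMap ⊤) γ ((B ^ m) w)
      ((B ^ m) ((V h).orthogonalProjectionOnto x)) :=
    Or.inl ⟨h0, (congrArg (fun L : V h →L[ℝ] V h => L ((V h).orthogonalProjectionOnto x))
      (commute_negPow hB γ).eq).symm⟩
  have hs := hC₁ h k hk m hm hmN w _ _ (schemeOp_pow_coe m w).symm hz
  have hc := hC₂ h (negPow A γ x) x (Or.inl ⟨h0, rfl⟩)
  have hkn : 0 ≤ (m * k : ℝ) ^ (-γ) := Real.rpow_nonneg (mul_nonneg m.cast_nonneg hk.1.le) _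
  rw [schemeOp_pow_eq hm, ← Submodule.coe_norm]
  calc _ ≤ C₁ * (m * k) ^ (-γ) * ‖(w : H)‖ := hs
    _ ≤ |C₁| * (m * k) ^ (-γ) * (|C₂| * ‖negPow A γ x‖) := by
        gcongr
        · exact le_abs_self _
        · exact hc.trans (by gcongr; exact le_abs_self _)
    _ = _ := by ring

/-- Stability of the scheme. -/
theorem SchemeAssumptions.exists_norm_pow_le (hV : SchemeAssumptions V Ah T A S) :
    ∃ C : ℝ, 0 ≤ C ∧ ∀ h, ∀ k ∈ Ioc (0 : ℝ) 1, ∀ m : ℕ, 1 ≤ m → m ≤ numSteps T k →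
      ‖schemeOp V Ah h k ^ m‖ ≤ C := by
  obtain ⟨C, hC⟩ := hV.smoothing 0 le_rfl (by norm_num)
  refine ⟨|C|, abs_nonneg _, fun h k hk m hm hmN => ?_⟩
  refine ContinuousLinearMap.opNorm_le_bound _ (abs_nonneg _) fun x => ?_
  rw [schemeOp_pow_eq hm, ← Submodule.coe_norm]
  have hz : ∀ z, IsFracPow ((Ah h).toPMap ⊤) 0 z z := fun z => Or.inl ⟨le_rfl, by simp [negPow]⟩
  have := hC h k hk m hm hmN x _ _ (schemeOp_pow_eq hm x).symm (hz _)
  rw [neg_zero, Real.rpow_zero, mul_one] at this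
  exact this.trans (by gcongr; exact le_abs_self _)

end SchemeOperator

/-! ### Smooth random variables with values in a finite-dimensional space -/

section SmoothFunctionals

variable {Ω : Type*} [MeasurableSpace Ω] {P : Measure Ω}
  {U : Type*} [NormedAddCommGroup U] [InnerProductSpace ℝ U] [CompleteSpace U]
  {H : Type*} [NormedAddCommGroup H] [InnerProductSpace ℝ H]
  {T : ℝ} {W : ℝ → U →L[ℝ] Lp ℝ 2 P} {q : ℝ≥0∞}
  {V : Submodule ℝ H} [FiniteDimensional ℝ V]
  {ι : Type*} [Fintype ι] [DecidableEq ι]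

/-- The Malliavin derivative of a function of Wiener integrals, where `L` is the derivative of the
function and `φ i` is the integrand of the `i`-th integral. -/
def tangentLp (φ : ι → Lp U q (volume.restrict (Icc 0 T))) (L : (ι → ℝ) →L[ℝ] V) :
    Lp (HS U H) q (volume.restrict (Icc 0 T)) :=
  ∑ i, tensorLp (φ i) (L (Pi.single i 1) : H)

theorem continuous_tangentLp [Fact (1 ≤ q)] (φ : ι → Lp U q (volume.restrict (Icc 0 T))) :
    Continuous (tangentLp φ : ((ι → ℝ) →L[ℝ] V) → _) := by
  refine continuous_finsetSum _ fun i _ => ?_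
  have h1 : Continuous ((tensorLp (φ i) : H →ₗ[ℝ] _) ∘ₗ V.subtype) :=
    LinearMap.continuous_of_finiteDimensional _
  exact h1.comp (by fun_prop)

/-- A continuously differentiable function with bounded derivative of finitely many Wiener integrals,
with values in a finite-dimensional space, is a smooth random variable. -/
theorem isSmooth_of_contDiff {G : (ι → ℝ) → V} (hG : ContDiff ℝ 1 G) {C : ℝ}
    (hC : ∀ x, ‖fderiv ℝ G x‖ ≤ C) (φ : ι → Lp U q (volume.restrict (Icc 0 T)))
    {Y : ι → Ω → ℝ} (hY : ∀ i, IsWienerIntegral T W (fun t => innerSL ℝ (φ i t)) (Y i))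
    {X : Ω → H} (hX : ∀ᵐ ω ∂P, X ω = G fun i => Y i ω) :
    IsSmooth T W q X fun ω => tangentLp φ (fderiv ℝ G fun i => Y i ω) := by
  let σ := Fintype.equivFin ι
  let e := stdOrthonormalBasis ℝ V
  -- the variables are renumbered by `Fin`
  let r : (Fin (Fintype.card ι) → ℝ) →L[ℝ] (ι → ℝ) :=
    ContinuousLinearMap.pi fun i => ContinuousLinearMap.proj (σ i)
  have hr : ∀ i, r (Pi.single i 1) = Pi.single (σ.symm i) 1 := by
    intro i
    ext l
    simp only [r, ContinuousLinearMap.coe_pi', ContinuousLinearMap.proj_apply, Pi.single_apply]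
    simp [Equiv.eq_symm_apply]
  have hd : ∀ j x, HasFDerivAt (fun x => inner ℝ (e j) (G (r x)))
      ((innerSL ℝ (e j)) ∘L (fderiv ℝ G (r x)) ∘L r) x := by
    intro j x
    have h1 := (hG.differentiable one_ne_zero (r x)).hasFDerivAt.comp x r.hasFDerivAt
    exact (innerSL ℝ (e j)).hasFDerivAt.comp x h1
  refine ⟨_, fun j => (e j : H), fun j ω => inner ℝ (e j) (G fun i => Y i ω),
    fun j ω => ∑ i, (inner ℝ (e j) (fderiv ℝ G (fun i => Y i ω) (Pi.single i 1)) : ℝ) • φ i,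
    fun j => ?_, ?_, ?_⟩
  · refine ⟨_, fun x => inner ℝ (e j) (G (r x)), fun i => φ (σ.symm i), fun i => Y (σ.symm i),
      ⟨?_, C * ‖r‖, 0, fun x => ?_⟩, fun i => hY _, ?_, ?_⟩
    · exact (innerSL ℝ (e j)).contDiff.comp (hG.comp r.contDiff)
    · rw [(hd j x).fderiv]
      have hC0 : 0 ≤ C := (ContinuousLinearMap.opNorm_nonneg _).trans (hC 0)
      have h1 : ‖innerSL ℝ (e j)‖ ≤ 1 := by
        rw [innerSL_apply_norm, e.norm_eq_one]
      calc _ ≤ ‖innerSL ℝ (e j)‖ * (‖fderiv ℝ G (r x)‖ * ‖r‖) :=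
            (ContinuousLinearMap.opNorm_comp_le _ _).trans
              (by gcongr; exact ContinuousLinearMap.opNorm_comp_le _ _)
        _ ≤ 1 * (C * ‖r‖) := by
            gcongr
            exact hC _
        _ ≤ _ := by
            rw [pow_zero]
            nlinarith [mul_nonneg hC0 (norm_nonneg r)]
    · refine Eventually.of_forall fun ω => ?_
      simp [r]
    · refine Eventually.of_forall fun ω => ?_
      simp only [(hd j _).fderiv]
      rw [← Equiv.sum_comp σ.symm]
      refine Finset.sum_congr rfl fun i _ => ?_
      simp only [ContinuousLinearMap.comp_apply, hr]
      simp [r]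
  · filter_upwards [hX] with ω hω
    rw [hω]
    have h := congrArg Subtype.val (e.sum_repr' (G fun i => Y i ω))
    simp only [AddSubmonoidClass.coe_finsetSum, Submodule.coe_smul] at h
    exact h.symm
  · refine Eventually.of_forall fun ω => ?_
    change _ = ∑ j, tensorLp _ _
    simp only [tensorLp_sum]
    rw [Finset.sum_comm]
    refine Finset.sum_congr rfl fun i _ => ?_
    have h := congrArg Subtype.val (e.sum_repr' (fderiv ℝ G (fun i => Y i ω) (Pi.single i 1)))
    simp only [AddSubmonoidClass.coe_finsetSum, Submodule.coe_smul] at h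
    nth_rw 1 [← h]
    simp only [map_sum, map_smul]

/-- For a smooth random variable the closure is not needed: the constant sequence approximates. -/
theorem malliavinNorm_le_of_isSmooth {p : ℝ≥0∞} [Fact (1 ≤ q)] {X : Ω → H}
    {DX : Ω → Lp (HS U H) q (volume.restrict (Icc 0 T))} (h : IsSmooth T W q X DX)
    (hX : MemLp X p P) (hDX : MemLp DX p P) {a b : ℝ≥0∞} (ha : eLpNorm X p P ≤ a)
    (hb : eLpNorm DX p P ≤ b) :
    malliavinNorm T W p q X ≤ (a ^ p.toReal + b ^ p.toReal) ^ (1 / p.toReal) := by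
  refine (iInf₂_le DX ⟨hX, hDX, fun _ => X, fun _ => DX, fun _ => h, by simp, by simp⟩).trans ?_
  gcongr

end SmoothFunctionals

/-! ### The scheme as a function of the Gaussian increments -/

section SchemeMap

variable {U : Type*} [NormedAddCommGroup U] [InnerProductSpace ℝ U] [CompleteSpace U]
  {H : Type*} [NormedAddCommGroup H] [InnerProductSpace ℝ H]
  {V : Submodule ℝ H} [FiniteDimensional ℝ V]

/-- The index set of the increments of `N` steps: the step, and the coordinate in `V`. -/
abbrev NoiseIndex (V : Submodule ℝ H) (N : ℕ) : Type := Fin N × Fin (Module.finrank ℝ V)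

/-- The `V`-valued increment of the `n`-th step, as a function of all coordinates. -/
def noiseMap (V : Submodule ℝ H) [FiniteDimensional ℝ V] (N n : ℕ) :
    (NoiseIndex V N → ℝ) →L[ℝ] V :=
  ∑ i : NoiseIndex V N, if (i.1 : ℕ) = n then
    (ContinuousLinearMap.proj i).smulRight (stdOrthonormalBasis ℝ V i.2) else 0

theorem noiseMap_apply {N n : ℕ} (hn : n < N) (x : NoiseIndex V N → ℝ) :
    noiseMap V N n x = ∑ i, x (⟨n, hn⟩, i) • stdOrthonormalBasis ℝ V i := by
  rw [noiseMap, Fintype.sum_prod_type, Finset.sum_eq_single_of_mem ⟨n, hn⟩ (Finset.mem_univ _)]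
  · simp
  · intro j _ hj
    exact Finset.sum_eq_zero fun i _ => if_neg fun h => hj (Fin.ext h)

theorem noiseMap_single {N n : ℕ} (i : NoiseIndex V N) :
    noiseMap V N n (Pi.single i 1) =
      if (i.1 : ℕ) = n then stdOrthonormalBasis ℝ V i.2 else 0 := by
  rw [noiseMap, _root_.sum_apply, Finset.sum_eq_single_of_mem i (Finset.mem_univ _)]
  · split_ifs <;> simp
  · intro j _ hj
    split_ifs
    · simp [hj]
    · simp

/-- The `n`-th step of the recursion `x ↦ B x + k B F(x) + ξ`, as a function of the increments. -/
def schemeMap (B : H →L[ℝ] V) (F : H → H) (k : ℝ) (x₀ : V) (N : ℕ) :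
    ℕ → (NoiseIndex V N → ℝ) → V
  | 0, _ => x₀
  | n + 1, x => B (schemeMap B F k x₀ N n x) + k • B (F (schemeMap B F k x₀ N n x)) +
      noiseMap V N n x

variable {B : H →L[ℝ] V} {F : H → H} {D : H → H →L[ℝ] H} {k : ℝ} {x₀ : V} {N : ℕ}

theorem hasFDerivAt_schemeMap_succ (hF : IsGateauxDeriv F D) {n : ℕ} {x : NoiseIndex V N → ℝ}
    {L : (NoiseIndex V N → ℝ) →L[ℝ] V} (h : HasFDerivAt (schemeMap B F k x₀ N n) L x) :
    HasFDerivAt (schemeMap B F k x₀ N (n + 1)) (B ∘L V.subtypeL ∘L L +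
      k • (B ∘L D (schemeMap B F k x₀ N n x) ∘L V.subtypeL ∘L L) + noiseMap V N n) x := by
  have h1 : HasFDerivAt (fun x => (schemeMap B F k x₀ N n x : H)) (V.subtypeL ∘L L) x :=
    V.subtypeL.hasFDerivAt.comp x h
  have h2 : HasFDerivAt (fun x => F (schemeMap B F k x₀ N n x))
      (D (schemeMap B F k x₀ N n x) ∘L V.subtypeL ∘L L) x :=
    ((hF.comp_clm V.subtypeL).hasFDerivAt (schemeMap B F k x₀ N n x)).comp x h
  exact ((B.hasFDerivAt.comp x h1).add ((B.hasFDerivAt.comp x h2).const_smul k)).add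
    (noiseMap V N n).hasFDerivAt

theorem contDiff_schemeMap (hF : IsGateauxDeriv F D) (n : ℕ) :
    ContDiff ℝ 1 (schemeMap B F k x₀ N n) := by
  induction n with
  | zero => exact contDiff_const
  | succ n ih =>
    exact ((B.contDiff.comp (V.subtypeL.contDiff.comp ih)).add
      ((B.contDiff.comp ((hF.comp_clm V.subtypeL).contDiff.comp ih)).const_smul k)).add
      (noiseMap V N n).contDiff

theorem fderiv_schemeMap_succ (hF : IsGateauxDeriv F D) (n : ℕ) (x : NoiseIndex V N → ℝ) :
    fderiv ℝ (schemeMap B F k x₀ N (n + 1)) x =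
      B ∘L V.subtypeL ∘L fderiv ℝ (schemeMap B F k x₀ N n) x +
      k • (B ∘L D (schemeMap B F k x₀ N n x) ∘L V.subtypeL ∘L
        fderiv ℝ (schemeMap B F k x₀ N n) x) + noiseMap V N n :=
  (hasFDerivAt_schemeMap_succ hF
    ((contDiff_schemeMap hF n).differentiable one_ne_zero x).hasFDerivAt).fderiv

theorem exists_norm_fderiv_schemeMap_le (hF : IsGateauxDeriv F D) {L : ℝ} (hL : ∀ x, ‖D x‖ ≤ L)
    (n : ℕ) : ∃ C : ℝ, ∀ x, ‖fderiv ℝ (schemeMap B F k x₀ N n) x‖ ≤ C := by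
  induction n with
  | zero =>
    refine ⟨0, fun x => ?_⟩
    have : schemeMap B F k x₀ N 0 = fun _ => x₀ := rfl
    rw [this, fderiv_const_apply]
    exact ContinuousLinearMap.opNorm_zero.le
  | succ n ih =>
    obtain ⟨C, hC⟩ := ih
    refine ⟨‖B‖ * (‖V.subtypeL‖ * C) + ‖k‖ * (‖B‖ * (L * (‖V.subtypeL‖ * C))) + ‖noiseMap V N n‖,
      fun x => ?_⟩
    have h1 : ‖V.subtypeL ∘L fderiv ℝ (schemeMap B F k x₀ N n) x‖ ≤ ‖V.subtypeL‖ * C :=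
      (ContinuousLinearMap.opNorm_comp_le _ _).trans (by gcongr; exact hC x)
    rw [fderiv_schemeMap_succ hF]
    refine (ContinuousLinearMap.opNorm_add_le _ _).trans
      (add_le_add_left ((ContinuousLinearMap.opNorm_add_le _ _).trans (add_le_add ?_ ?_)) _)
    · exact (ContinuousLinearMap.opNorm_comp_le _ _).trans (by gcongr)
    · refine (ContinuousLinearMap.opNorm_smul_le _ _).trans ?_
      gcongr
      refine (ContinuousLinearMap.opNorm_comp_le _ _).trans ?_
      gcongr
      refine (ContinuousLinearMap.opNorm_comp_le _ _).trans ?_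
      have h0 : 0 ≤ L := (norm_nonneg _).trans (hL 0)
      gcongr
      exact hL _

/-- The linearized recursion, solved by variation of constants. -/
theorem fderiv_schemeMap_apply (hF : IsGateauxDeriv F D) (n : ℕ) (x v : NoiseIndex V N → ℝ) :
    (fderiv ℝ (schemeMap B F k x₀ N n) x v : H) =
      ∑ j ∈ Finset.range n, ((k • ((V.subtypeL ∘L B) ^ (n - j)) ∘L D (schemeMap B F k x₀ N j x))
          (fderiv ℝ (schemeMap B F k x₀ N j) x v : H) +
        ((V.subtypeL ∘L B) ^ (n - 1 - j)) (noiseMap V N j v : H)) := by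
  have h := eq_pow_add_sum_of_recursion (V.subtypeL ∘L B)
    (a := fun n => (fderiv ℝ (schemeMap B F k x₀ N n) x v : H))
    (b := fun n => k • (V.subtypeL ∘L B) (D (schemeMap B F k x₀ N n x)
      (fderiv ℝ (schemeMap B F k x₀ N n) x v)) + (noiseMap V N n v : H)) (N := n)
    (fun j _ => by
      simp only [fderiv_schemeMap_succ hF]
      simp [add_assoc]) n le_rfl
  have h0 : fderiv ℝ (schemeMap B F k x₀ N 0) x = 0 := by
    have : schemeMap B F k x₀ N 0 = fun _ => x₀ := rfl
    rw [this]
    simp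
  rw [h0, _root_.zero_apply, Submodule.coe_zero, map_zero, zero_add] at h
  rw [h]
  refine Finset.sum_congr rfl fun j hj => ?_
  have hj' := Finset.mem_range.1 hj
  rw [map_add, map_smul, ← mul_apply_eq_comp, ← pow_succ, show n - 1 - j + 1 = n - j by omega]
  rfl

end SchemeMap

/-! ### Bound of the Malliavin derivative -/

section DerivativeBound

variable {U : Type*} [NormedAddCommGroup U] [InnerProductSpace ℝ U] [CompleteSpace U]
  {H : Type*} [NormedAddCommGroup H] [InnerProductSpace ℝ H] [CompleteSpace H]
  {V : Submodule ℝ H} [FiniteDimensional ℝ V]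
  {B : H →L[ℝ] V} {F : H → H} {D : H → H →L[ℝ] H} {k : ℝ} {x₀ : V} {N : ℕ}

/-- The function `1_{(jk, (j+1)k]} c` on `[0, T]`. -/
def stepLp {E : Type*} [NormedAddCommGroup E] (T : ℝ) (q : ℝ≥0∞) (k : ℝ) (j : ℕ) (c : E) :
    Lp E q (volume.restrict (Icc 0 T)) :=
  indicatorConstLp q (measurableSet_Ioc (a := (j : ℝ) * k) (b := ((j + 1 : ℕ) : ℝ) * k))
    (measure_lt_top _ _).ne c

theorem stepLp_coeFn {E : Type*} [NormedAddCommGroup E] (T : ℝ) (q : ℝ≥0∞) (k : ℝ) (j : ℕ)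
    (c : E) :
    stepLp T q k j c =ᵐ[volume.restrict (Icc 0 T)]
      (Ioc (j * k) ((j + 1 : ℕ) * k)).indicator fun _ => c :=
  indicatorConstLp_coeFn

theorem enorm_sum_stepLp {E : Type*} [NormedAddCommGroup E] (T : ℝ) (q : ℝ≥0∞) (k : ℝ) (n : ℕ)
    (c : ℕ → E) : ‖∑ j ∈ Finset.range n, stepLp T q k j (c j)‖ₑ =
      eLpNorm (fun x => ∑ j ∈ Finset.range n,
        (Ioc (j * k) ((j + 1 : ℕ) * k)).indicator (fun _ => c j) x) q
        (volume.restrict (Icc 0 T)) := by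
  rw [Lp.enorm_def]
  refine eLpNorm_congr_ae ((Lp.coeFn_finsetSum _ _).trans ?_)
  filter_upwards [ae_all_iff.2 fun j => stepLp_coeFn T q k j (c j)] with t ht
  rw [Finset.sum_apply]
  exact Finset.sum_congr rfl fun j _ => ht j

/-- The integrands of the coordinates of the increments `∫ Φ dW` over the steps. -/
def noiseIntegrand (V : Submodule ℝ H) [FiniteDimensional ℝ V] (T : ℝ) (q : ℝ≥0∞) (k : ℝ)
    (Φ : U →L[ℝ] H) (N : ℕ) (i : NoiseIndex V N) : Lp U q (volume.restrict (Icc 0 T)) :=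
  stepLp T q k i.1 (Φ.adjoint (stdOrthonormalBasis ℝ V i.2))

/-- The Hilbert-Schmidt operator `B ∘ Φ`, where `Φ` has values in `V`. -/
def blockHS (V : Submodule ℝ H) [FiniteDimensional ℝ V] (Φ : U →L[ℝ] H) (B : H →L[ℝ] H) : HS U H :=
  ∑ i, hsTensor (B (stdOrthonormalBasis ℝ V i : H)) (Φ.adjoint (stdOrthonormalBasis ℝ V i))

theorem enorm_blockHS_sq {Φ : U →L[ℝ] H} (hΦ : ∀ x, Φ x ∈ V) (B : H →L[ℝ] H) :
    ‖blockHS V Φ B‖ₑ ^ 2 = hsSq (B ∘L Φ) := by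
  rw [HS.enorm_sq, blockHS, map_sum]
  simp only [HS.toCLM_hsTensor]
  rw [sum_rankOne_comp_adjoint V hΦ]

theorem sum_tensorLp_noiseIntegrand {T : ℝ} {q : ℝ≥0∞} (Φ : U →L[ℝ] H) (B : H →L[ℝ] H) {j : ℕ}
    (hj : j < N) :
    ∑ i, tensorLp (noiseIntegrand V T q k Φ N i) (B (noiseMap V N j (Pi.single i 1) : H)) =
      stepLp T q k j (blockHS V Φ B) := by
  rw [Fintype.sum_prod_type, Finset.sum_eq_single_of_mem ⟨j, hj⟩ (Finset.mem_univ _)]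
  · have h : ∀ s : Finset (Fin (Module.finrank ℝ V)), ∀ c : Fin (Module.finrank ℝ V) → HS U H,
        stepLp T q k j (∑ i ∈ s, c i) = ∑ i ∈ s, stepLp T q k j (c i) := by
      intro s c
      induction s using Finset.induction_on with
      | empty =>
        simp [stepLp, indicatorConstLp]
      | insert a s ha ih =>
        rw [Finset.sum_insert ha, Finset.sum_insert ha, ← ih]
        exact (indicatorConstLp_add).symm
    rw [blockHS, h]
    refine Finset.sum_congr rfl fun i _ => ?_
    rw [noiseMap_single, if_pos rfl, tensorLp_apply, noiseIntegrand, stepLp,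
      compLp_indicatorConstLp]
    rfl
  · intro l _ hl
    refine Finset.sum_eq_zero fun i _ => ?_
    rw [noiseMap_single, if_neg fun h => hl (Fin.ext h)]
    simp

/-- The derivative of the scheme solves the linearized recursion. -/
theorem tangentLp_fderiv_schemeMap (hF : IsGateauxDeriv F D) {T : ℝ} {q : ℝ≥0∞} [Fact (1 ≤ q)]
    (Φ : U →L[ℝ] H) {n : ℕ} (hn : n ≤ N) (x : NoiseIndex V N → ℝ) :
    tangentLp (noiseIntegrand V T q k Φ N) (fderiv ℝ (schemeMap B F k x₀ N n) x) =
      ∑ j ∈ Finset.range n,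
        (HS.lcomp ((k • ((V.subtypeL ∘L B) ^ (n - j)) ∘L D (schemeMap B F k x₀ N j x)))).compLp
          (tangentLp (noiseIntegrand V T q k Φ N) (fderiv ℝ (schemeMap B F k x₀ N j) x)) +
      ∑ j ∈ Finset.range n, stepLp T q k j (blockHS V Φ ((V.subtypeL ∘L B) ^ (n - 1 - j))) := by
  rw [tangentLp]
  simp only [fderiv_schemeMap_apply hF n x, map_sum, map_add]
  rw [Finset.sum_comm, ← Finset.sum_add_distrib]
  refine Finset.sum_congr rfl fun j hj => ?_
  have hj' := (Finset.mem_range.1 hj).trans_le hn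
  rw [Finset.sum_add_distrib, sum_tensorLp_noiseIntegrand Φ _ hj']
  congr 1
  simp only [← compLp_tensorLp]
  rw [tangentLp]
  exact (map_sum (ContinuousLinearMap.compLpₗ q (volume.restrict (Icc 0 T)) (HS.lcomp _)) _ _).symm

/-- Bound of the Malliavin derivative by the discrete Gronwall inequality. -/
theorem enorm_tangentLp_schemeMap_le (hF : IsGateauxDeriv F D) {L C T : ℝ} (hL : ∀ x, ‖D x‖ ≤ L)
    (hk : 0 ≤ k) (hC : 0 ≤ C) (hS : ∀ m, 1 ≤ m → m ≤ N → ‖(V.subtypeL ∘L B) ^ m‖ ≤ C)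
    {q : ℝ≥0∞} [Fact (1 ≤ q)] {Φ : U →L[ℝ] H} {K : ℝ≥0∞}
    (hK : ∀ n ≤ N, ‖∑ j ∈ Finset.range n,
      stepLp T q k j (blockHS V Φ ((V.subtypeL ∘L B) ^ (n - 1 - j)))‖ₑ ≤ K)
    {n : ℕ} (hn : n ≤ N) (x : NoiseIndex V N → ℝ) :
    ‖tangentLp (noiseIntegrand V T q k Φ N) (fderiv ℝ (schemeMap B F k x₀ N n) x)‖ₑ ≤
      K * (1 + ENNReal.ofReal (k * (C * L))) ^ n := by
  have hL0 : 0 ≤ L := (norm_nonneg _).trans (hL 0)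
  refine le_mul_pow_of_le_add_mul_sum (a := fun n =>
    ‖tangentLp (noiseIntegrand V T q k Φ N) (fderiv ℝ (schemeMap B F k x₀ N n) x)‖ₑ) ?_ n hn
  intro n hn
  rw [tangentLp_fderiv_schemeMap hF Φ hn, add_comm]
  refine (enorm_add_le _ _).trans (add_le_add (hK n hn) ?_)
  rw [Finset.mul_sum]
  refine (enorm_sum_le _ _).trans (Finset.sum_le_sum fun j hj => ?_)
  have hj' := Finset.mem_range.1 hj
  have hop : ‖(k • ((V.subtypeL ∘L B) ^ (n - j))) ∘L D (schemeMap B F k x₀ N j x)‖ ≤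
      k * (C * L) := by
    refine (ContinuousLinearMap.opNorm_comp_le _ _).trans ?_
    rw [norm_smul, Real.norm_of_nonneg hk, mul_assoc]
    have h1 := hS (n - j) (by omega) (by omega)
    have h2 := hL (schemeMap B F k x₀ N j x)
    gcongr
  exact enorm_compLp_lcomp_le _ hop _

end DerivativeBound

/-! ### Moment bound of the scheme -/

section MomentBound

variable {Ω : Type*} [MeasurableSpace Ω] {P : Measure Ω} [IsProbabilityMeasure P]
  {H : Type*} [NormedAddCommGroup H]

theorem eLpNorm_comp_le_of_linear_growth {F : H → H} {a L : ℝ} (hL : 0 ≤ L)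
    (ha : ∀ x, ‖F x‖ ≤ a + L * ‖x‖) {X : Ω → H} (hX : AEStronglyMeasurable X P) {p : ℝ≥0∞}
    (hp : 1 ≤ p) :
    eLpNorm (fun ω => F (X ω)) p P ≤ ENNReal.ofReal a + ENNReal.ofReal L * eLpNorm X p P := by
  have ha0 : 0 ≤ a := by
    have := (norm_nonneg _).trans (ha 0)
    simpa using this
  calc eLpNorm (fun ω => F (X ω)) p P ≤ eLpNorm (fun ω => a + L * ‖X ω‖) p P :=
        eLpNorm_mono_real fun ω => ha _
    _ ≤ eLpNorm (fun _ : Ω => a) p P + eLpNorm (fun ω => L * ‖X ω‖) p P :=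
        eLpNorm_add_le aestronglyMeasurable_const (hX.norm.const_mul L) hp
    _ = ENNReal.ofReal a + ENNReal.ofReal L * eLpNorm X p P := by
        rw [eLpNorm_const a (by positivity) (NeZero.ne P)]
        congr 1
        · rw [measure_univ, ENNReal.one_rpow, mul_one, Real.enorm_of_nonneg ha0]
        · change eLpNorm (L • fun ω => ‖X ω‖) p P = _
          rw [eLpNorm_const_smul, Real.enorm_of_nonneg hL, eLpNorm_norm]

variable [NormedSpace ℝ H]

/-- Moment bound of a stochastic recursion in the variation of constants form, by the discrete
Gronwall inequality. -/
theorem eLpNorm_le_of_recursion {F : H → H} (hFc : Continuous F) {a L C k : ℝ} (hL : 0 ≤ L)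
    (ha : ∀ x, ‖F x‖ ≤ a + L * ‖x‖) (hk : 0 ≤ k) (hC : 0 ≤ C) {S : H →L[ℝ] H} {N : ℕ}
    (hS : ∀ m, 1 ≤ m → m ≤ N → ‖S ^ m‖ ≤ C) {X Z : ℕ → Ω → H} {p : ℝ≥0∞} (hp : 1 ≤ p)
    (hXm : ∀ n ≤ N, AEStronglyMeasurable (X n) P) (hZm : ∀ n ≤ N, AEStronglyMeasurable (Z n) P)
    {x₀ : H} {T : ℝ} (hNk : N * k ≤ T) {K : ℝ≥0∞} (hK : ∀ n ≤ N, eLpNorm (Z n) p P ≤ K)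
    (hrec : ∀ n ≤ N, ∀ᵐ ω ∂P, X n ω = (S ^ n) x₀ +
      ∑ j ∈ Finset.range n, k • (S ^ (n - j)) (F (X j ω)) + Z n ω) {n : ℕ} (hn : n ≤ N) :
    eLpNorm (X n) p P ≤ (ENNReal.ofReal ((1 + C) * ‖x₀‖ + T * C * a) + K) *
      (1 + ENNReal.ofReal (k * (C * L))) ^ n := by
  have ha0 : 0 ≤ a := by
    have := (norm_nonneg _).trans (ha 0)
    simpa using this
  refine le_mul_pow_of_le_add_mul_sum (a := fun n => eLpNorm (X n) p P) ?_ n hn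
  intro n hn
  have hFm : ∀ j < n, AEStronglyMeasurable (fun ω => k • (S ^ (n - j)) (F (X j ω))) P :=
    fun j hj => ((S ^ (n - j)).continuous.comp hFc).const_smul k
      |>.comp_aestronglyMeasurable (hXm j (hj.le.trans hn))
  have hsm : AEStronglyMeasurable
      (fun ω => ∑ j ∈ Finset.range n, k • (S ^ (n - j)) (F (X j ω))) P :=
    Finset.aestronglyMeasurable_fun_sum _ fun j hj => hFm j (Finset.mem_range.1 hj)
  have h0 : eLpNorm (fun _ : Ω => (S ^ n) x₀) p P ≤ ENNReal.ofReal ((1 + C) * ‖x₀‖) := by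
    rw [eLpNorm_const _ (by positivity) (NeZero.ne P), measure_univ, ENNReal.one_rpow, mul_one,
      ← ofReal_norm]
    refine ENNReal.ofReal_le_ofReal ?_
    rcases Nat.eq_zero_or_pos n with rfl | hpos
    · rw [pow_zero, one_apply_eq_self]
      nlinarith [norm_nonneg x₀]
    · refine ((S ^ n).le_opNorm x₀).trans ?_
      gcongr
      linarith [hS n hpos hn]
  have h1 : eLpNorm (fun ω => ∑ j ∈ Finset.range n, k • (S ^ (n - j)) (F (X j ω))) p P ≤
      ENNReal.ofReal (T * C * a) +
        ENNReal.ofReal (k * (C * L)) * ∑ j ∈ Finset.range n, eLpNorm (X j) p P := by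
    have hterm : ∀ j ∈ Finset.range n, eLpNorm (fun ω => k • (S ^ (n - j)) (F (X j ω))) p P ≤
        ENNReal.ofReal (k * C * a) + ENNReal.ofReal (k * (C * L)) * eLpNorm (X j) p P := by
      intro j hj
      have hj' := Finset.mem_range.1 hj
      have hg : ∀ x, ‖k • (S ^ (n - j)) (F x)‖ ≤ k * C * a + k * (C * L) * ‖x‖ := by
        intro x
        rw [norm_smul, Real.norm_of_nonneg hk]
        calc k * ‖(S ^ (n - j)) (F x)‖ ≤ k * (C * (a + L * ‖x‖)) := by
              gcongr
              refine ((S ^ (n - j)).le_opNorm _).trans ?_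
              gcongr
              · exact hS _ (by omega) (by omega)
              · exact ha x
          _ = _ := by ring
      exact eLpNorm_comp_le_of_linear_growth (by positivity) hg (hXm j (hj'.le.trans hn)) hp
    have hsum := eLpNorm_sum_le (f := fun j ω => k • (S ^ (n - j)) (F (X j ω)))
      (s := Finset.range n) (fun j hj => hFm j (Finset.mem_range.1 hj)) hp
    rw [show (fun ω => ∑ j ∈ Finset.range n, k • (S ^ (n - j)) (F (X j ω))) =
      ∑ j ∈ Finset.range n, fun ω => k • (S ^ (n - j)) (F (X j ω)) by
        ext ω
        rw [Finset.sum_apply]]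
    refine hsum.trans ((Finset.sum_le_sum hterm).trans ?_)
    rw [Finset.sum_add_distrib, ← Finset.mul_sum, Finset.sum_const, Finset.card_range, nsmul_eq_mul]
    gcongr
    rw [← ENNReal.ofReal_natCast, ← ENNReal.ofReal_mul n.cast_nonneg]
    refine ENNReal.ofReal_le_ofReal ?_
    have hnk : n * k ≤ T := (by gcongr : (n : ℝ) * k ≤ N * k).trans hNk
    calc n * (k * C * a) = (n * k) * (C * a) := by ring
      _ ≤ T * (C * a) := by gcongr
      _ = _ := by ring
  have hTnn : 0 ≤ T := (by positivity : (0 : ℝ) ≤ N * k).trans hNk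
  calc eLpNorm (X n) p P = eLpNorm (fun ω => (S ^ n) x₀ +
        ∑ j ∈ Finset.range n, k • (S ^ (n - j)) (F (X j ω)) + Z n ω) p P :=
        eLpNorm_congr_ae (hrec n hn)
    _ ≤ ENNReal.ofReal ((1 + C) * ‖x₀‖) + (ENNReal.ofReal (T * C * a) +
        ENNReal.ofReal (k * (C * L)) * ∑ j ∈ Finset.range n, eLpNorm (X j) p P) + K :=
        (eLpNorm_add_le (aestronglyMeasurable_const.add hsm) (hZm n hn) hp).trans
          (add_le_add ((eLpNorm_add_le aestronglyMeasurable_const hsm hp).trans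
            (add_le_add h0 h1)) (hK n hn))
    _ = _ := by
        rw [ENNReal.ofReal_add (by positivity) (by positivity)]
        ring

end MomentBound

/-! ### Representation of the scheme by Gaussian increments -/

section Increments

variable {Ω : Type*} [MeasurableSpace Ω] {P : Measure Ω}
  {U : Type*} [NormedAddCommGroup U] [InnerProductSpace ℝ U] [CompleteSpace U]
  {H : Type*} [NormedAddCommGroup H] [InnerProductSpace ℝ H] [CompleteSpace H]
  {T : ℝ}

theorem isWienerIntegral_increment (W : ℝ → U →L[ℝ] Lp ℝ 2 P) {a b : ℝ} (ha : 0 ≤ a) (hab : a ≤ b)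
    (hb : b ≤ T) (u : U) {φ : ℝ → U}
    (hφ : φ =ᵐ[volume.restrict (Icc 0 T)] (Ioc a b).indicator fun _ => u) :
    IsWienerIntegral T W (fun t => innerSL ℝ (φ t)) (fun ω => W b u ω - W a u ω) := by
  let s : ElemIntegrand T U ℝ :=
    ⟨1, fun _ => a, fun _ => b, fun _ => u, fun _ => 1, fun _ => ha, fun _ => hab, fun _ => hb⟩
  have hs : s.integral W = fun ω => W b u ω - W a u ω := by
    ext ω
    simp [ElemIntegrand.integral, s]
  rw [← hs]
  refine isWienerIntegral_elem s W ?_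
  filter_upwards [hφ] with t ht
  rw [ht, ElemIntegrand.fn, Fin.sum_univ_one]
  change _ = (Ioc a b).indicator (fun _ => InnerProductSpace.rankOne ℝ (1 : ℝ) u) t
  ext x
  by_cases h : t ∈ Ioc a b <;> simp [h]

theorem aestronglyMeasurable_blockIncrement (V : Submodule ℝ H) [FiniteDimensional ℝ V]
    (W : ℝ → U →L[ℝ] Lp ℝ 2 P) (Φ : U →L[ℝ] H) (a b : ℝ) :
    AEStronglyMeasurable (blockIncrement V W Φ a b) P :=
  Finset.aestronglyMeasurable_fun_sum _ fun _ _ =>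
    (memLp_increment W _ _ _).aestronglyMeasurable.smul_const _

/-- The increments of the coordinates of the noise of the scheme. -/
def coordIncrement (V : Submodule ℝ H) [FiniteDimensional ℝ V] (W : ℝ → U →L[ℝ] Lp ℝ 2 P)
    (Φ : U →L[ℝ] H) (k : ℝ) (N : ℕ) (i : NoiseIndex V N) (ω : Ω) : ℝ :=
  W ((i.1 + 1 : ℕ) * k) (Φ.adjoint (stdOrthonormalBasis ℝ V i.2)) ω -
    W ((i.1 : ℕ) * k) (Φ.adjoint (stdOrthonormalBasis ℝ V i.2)) ω

theorem noiseMap_coordIncrement {V : Submodule ℝ H} [FiniteDimensional ℝ V]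
    (W : ℝ → U →L[ℝ] Lp ℝ 2 P) (Φ : U →L[ℝ] H) (k : ℝ) {N n : ℕ} (hn : n < N) (ω : Ω) :
    (noiseMap V N n (fun i => coordIncrement V W Φ k N i ω) : H) =
      blockIncrement V W Φ (n * k) ((n + 1 : ℕ) * k) ω := by
  rw [noiseMap_apply hn, AddSubmonoidClass.coe_finsetSum]
  rfl

end Increments

section Scheme

variable {Ω : Type*} [MeasurableSpace Ω] {P : Measure Ω}
  {H : Type*} [NormedAddCommGroup H] [InnerProductSpace ℝ H] [CompleteSpace H]
  {V : Ioc (0 : ℝ) 1 → Submodule ℝ H} [∀ h, FiniteDimensional ℝ (V h)]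
  {Ah : ∀ h, V h →ₗ[ℝ] V h} {T : ℝ} {F : H → H} {X₀ : H} {R : H →L[ℝ] H}
  {W : ℝ → CM R →L[ℝ] Lp ℝ 2 P} {h : Ioc (0 : ℝ) 1} {k : ℝ} {X : ℕ → Ω → H}

theorem mul_le_of_le_numSteps {n : ℕ} (hT : 0 ≤ T) (hk : 0 < k) (hn : n ≤ numSteps T k) :
    n * k ≤ T := by
  rw [← le_div_iff₀ hk]
  exact (Nat.cast_le.2 hn).trans (Nat.floor_le (by positivity))

theorem IsScheme.step (hX : IsScheme V Ah T F X₀ R W h k X) (hW : IsCylindricalWiener P T W)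
    (hT : 0 ≤ T) (hk : 0 < k) {n : ℕ} (hn : n < numSteps T k) :
    ∀ᵐ ω ∂P, X (n + 1) ω = schemeOp V Ah h k (X n ω) + k • schemeOp V Ah h k (F (X n ω)) +
      blockIncrement (V h) W (schemeOp V Ah h k ∘L CM.incl R) (n * k) ((n + 1 : ℕ) * k) ω := by
  obtain ⟨Y, hY, hXY⟩ := hX.2 n hn
  have hb := mul_le_of_le_numSteps hT hk (Nat.succ_le_of_lt hn)
  push_cast at hb ⊢
  filter_upwards [hXY, hY.ae_eq_blockIncrement (V := V h) hW (fun x => schemeOp_mem _)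
    (by positivity) (by linarith) hb] with ω h1 h2
  rw [h1, h2]

/-- The scheme is a deterministic function of finitely many Gaussian increments. -/
theorem IsScheme.ae_eq_schemeMap (hX : IsScheme V Ah T F X₀ R W h k X)
    (hW : IsCylindricalWiener P T W) (hT : 0 ≤ T) (hk : 0 < k) {n : ℕ} (hn : n ≤ numSteps T k) :
    ∀ᵐ ω ∂P, X n ω = schemeMap (schemeOpV V Ah h k) F k ((V h).orthogonalProjectionOnto X₀)
      (numSteps T k) n fun i =>
        coordIncrement (V h) W (schemeOp V Ah h k ∘L CM.incl R) k (numSteps T k) i ω := by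
  induction n with
  | zero => exact hX.1
  | succ n ih =>
    filter_upwards [ih (Nat.le_of_succ_le hn), hX.step hW hT hk hn] with ω h1 h2
    rw [h2, h1, ← noiseMap_coordIncrement W _ k hn]
    rfl

/-- The scheme in the variation of constants form. -/
theorem IsScheme.ae_eq_sum (hX : IsScheme V Ah T F X₀ R W h k X)
    (hW : IsCylindricalWiener P T W) (hT : 0 ≤ T) (hk : 0 < k) {n : ℕ} (hn : n ≤ numSteps T k) :
    ∀ᵐ ω ∂P, X n ω = (schemeOp V Ah h k ^ n) ((V h).orthogonalProjectionOnto X₀ : H) +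
      ∑ j ∈ Finset.range n, k • (schemeOp V Ah h k ^ (n - j)) (F (X j ω)) +
      ∑ j ∈ Finset.range n, blockIncrement (V h) W
        ((schemeOp V Ah h k ^ (n - 1 - j)) ∘L (schemeOp V Ah h k ∘L CM.incl R))
        (j * k) ((j + 1 : ℕ) * k) ω := by
  have h1 : ∀ᵐ ω ∂P, ∀ j < n, X (j + 1) ω = schemeOp V Ah h k (X j ω) +
      (k • schemeOp V Ah h k (F (X j ω)) + blockIncrement (V h) W
        (schemeOp V Ah h k ∘L CM.incl R) (j * k) ((j + 1 : ℕ) * k) ω) := by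
    refine ae_all_iff.2 fun j => eventually_imp_distrib_left.2 fun hj => ?_
    filter_upwards [hX.step hW hT hk (hj.trans_le hn)] with ω hω
    rw [hω, add_assoc]
  have h2 : ∀ᵐ ω ∂P, ∀ j < n, (schemeOp V Ah h k ^ (n - 1 - j))
      (blockIncrement (V h) W (schemeOp V Ah h k ∘L CM.incl R) (j * k) ((j + 1 : ℕ) * k) ω) =
      blockIncrement (V h) W ((schemeOp V Ah h k ^ (n - 1 - j)) ∘L
        (schemeOp V Ah h k ∘L CM.incl R)) (j * k) ((j + 1 : ℕ) * k) ω := by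
    refine ae_all_iff.2 fun j => eventually_imp_distrib_left.2 fun hj => ?_
    have hb := mul_le_of_le_numSteps hT hk ((Nat.succ_le_of_lt hj).trans hn)
    have hΦ : ∀ x, (schemeOp V Ah h k ∘L CM.incl R) x ∈ V h := fun x => schemeOp_mem _
    have hB : ∀ x, (schemeOp V Ah h k ^ (n - 1 - j)) ((schemeOp V Ah h k ∘L CM.incl R) x) ∈ V h :=
      fun x => schemeOp_pow_mem _ (hΦ x)
    have hab : (j : ℝ) * k ≤ ((j + 1 : ℕ) : ℝ) * k := by
      gcongr
      exact j.le_succ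
    exact hW.blockIncrement_comp hΦ hB (by positivity) hab hb
  filter_upwards [hX.1, h1, h2] with ω h0 h1 h2
  rw [eq_pow_add_sum_of_recursion (schemeOp V Ah h k) (a := fun n => X n ω) h1 n le_rfl, h0,
    add_assoc, ← Finset.sum_add_distrib]
  congr 1
  refine Finset.sum_congr rfl fun j hj => ?_
  have hj' := Finset.mem_range.1 hj
  rw [map_add, map_smul, h2 j hj', ← mul_apply_eq_comp, ← pow_succ,
    show n - 1 - j + 1 = n - j by omega]

end Scheme

/-! ### Uniform bounds of the noise -/

section NoiseBounds

variable {H : Type*} [NormedAddCommGroup H] [InnerProductSpace ℝ H]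
  {V : Ioc (0 : ℝ) 1 → Submodule ℝ H} [∀ h, FiniteDimensional ℝ (V h)]
  {Ah : ∀ h, V h →ₗ[ℝ] V h} {T : ℝ} {A : H →ₗ.[ℝ] H} {S : ℝ → H →L[ℝ] H}
  {U : Type*} [NormedAddCommGroup U] [InnerProductSpace ℝ U] [CompleteSpace U]

/-- `‖S_{h,k}^m Φ‖_{L₂} ≤ C t_m^{-γ}` if `A^{-γ} Φ` is a Hilbert-Schmidt operator. -/
theorem SchemeAssumptions.exists_hsSq_le (hV : SchemeAssumptions V Ah T A S) {γ : ℝ}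
    (h0 : 0 ≤ γ) (h1 : γ ≤ 1 / 2) {Φ : U →L[ℝ] H} (hΦ : hsSq (negPow A γ ∘L Φ) < ∞) :
    ∃ M : ℝ, 0 ≤ M ∧ ∀ h, ∀ k ∈ Ioc (0 : ℝ) 1, ∀ n : ℕ, n ≤ numSteps T k → ∀ j < n,
      hsSq ((schemeOp V Ah h k ^ (n - 1 - j)) ∘L (schemeOp V Ah h k ∘L Φ)) ≤
        ENNReal.ofReal (M * (((n - j : ℕ) : ℝ) * k) ^ (-γ)) ^ 2 := by
  obtain ⟨C, hC0, hC⟩ := hV.exists_norm_pow_apply_le h0 h1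
  set s := hsSq (negPow A γ ∘L Φ)
  refine ⟨C * Real.sqrt s.toReal, by positivity, fun h k hk n hn j hj => ?_⟩
  have hkn : 0 ≤ (((n - j : ℕ) : ℝ) * k) := mul_nonneg (Nat.cast_nonneg _) hk.1.le
  have hle : ∀ x, ‖((schemeOp V Ah h k ^ (n - 1 - j)) ∘L (schemeOp V Ah h k ∘L Φ)) x‖ₑ ≤
      ENNReal.ofReal (C * (((n - j : ℕ) : ℝ) * k) ^ (-γ)) * ‖(negPow A γ ∘L Φ) x‖ₑ := by
    intro x
    rw [← ofReal_norm, ← ofReal_norm, ← ENNReal.ofReal_mul (by positivity)]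
    refine ENNReal.ofReal_le_ofReal ?_
    have := hC h k hk (n - j) (by omega) (by omega) (Φ x)
    rwa [show n - j = n - 1 - j + 1 by omega, pow_succ, mul_apply_eq_comp,
      show n - 1 - j + 1 = n - j by omega] at this
  refine (hsSq_le_of_norm_le hle).trans (le_of_eq ?_)
  have hs : s = ENNReal.ofReal (Real.sqrt s.toReal) ^ 2 := by
    rw [← ENNReal.ofReal_pow (Real.sqrt_nonneg _), Real.sq_sqrt ENNReal.toReal_nonneg,
      ENNReal.ofReal_toReal hΦ.ne]
  change _ * s = _
  nth_rw 1 [hs]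
  rw [← mul_pow, ← ENNReal.ofReal_mul (by positivity), mul_right_comm]

/-- Bound, uniform in the step size, of the variance `∑ⱼ k ‖S_{h,k}^{n-j}‖²` of the stochastic
convolution. -/
theorem exists_sum_sq_rpow_neg_le {T δ M : ℝ} (hM : 0 ≤ M) (h0 : 0 ≤ δ) (h1 : δ < 1 / 2) :
    ∃ K : ℝ≥0, ∀ k : ℝ, 0 < k → ∀ n : ℕ, n * k ≤ T →
      ∑ j ∈ Finset.range n, ENNReal.ofReal k *
        ENNReal.ofReal (M * (((n - j : ℕ) : ℝ) * k) ^ (-δ)) ^ 2 ≤ K ^ 2 := by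
  refine ⟨NNReal.sqrt (M ^ 2 * (T ^ (1 - 2 * δ) / (1 - 2 * δ))).toNNReal, fun k hk n hn => ?_⟩
  rw [← ENNReal.coe_pow, NNReal.sq_sqrt]
  change _ ≤ ENNReal.ofReal _
  calc _ = ∑ j ∈ Finset.range n,
        ENNReal.ofReal (M ^ 2 * (k * (((n - j : ℕ) : ℝ) * k) ^ (-(2 * δ)))) := by
        refine Finset.sum_congr rfl fun j _ => ?_
        have hnn : 0 ≤ ((n - j : ℕ) : ℝ) * k := by positivity
        rw [← ENNReal.ofReal_pow (by positivity), ← ENNReal.ofReal_mul hk.le, mul_pow,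
          ← Real.rpow_mul_natCast hnn]
        congr 1
        push_cast
        rw [show -δ * 2 = -(2 * δ) by ring]
        ring
    _ = ENNReal.ofReal (M ^ 2 *
          ∑ j ∈ Finset.range n, k * (((n - j : ℕ) : ℝ) * k) ^ (-(2 * δ))) := by
        rw [Finset.mul_sum, ENNReal.ofReal_sum_of_nonneg fun j _ => by positivity]
    _ ≤ _ := by
        gcongr
        exact mul_sum_rpow_neg_le (by positivity) (by linarith) hk hn

end NoiseBounds

end SPDE

end

theorem proposition3 {H : Type*} [NormedAddCommGroup H] [InnerProductSpace ℝ H] [CompleteSpace H]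
    [TopologicalSpace.SeparableSpace H]
    {Ω : Type*} [MeasurableSpace Ω] (P : Measure Ω) [IsProbabilityMeasure P]
    (T : ℝ) (hT : 0 < T)
    (Q R : H →L[ℝ] H) (hQ : Q.IsPositive) (hR : R.IsPositive) (hRQ : R ∘L R = Q)
    (W : ℝ → SPDE.CM R →L[ℝ] Lp ℝ 2 P) (hW : SPDE.IsCylindricalWiener P T W)
    (A : H →ₗ.[ℝ] H) (S : ℝ → H →L[ℝ] H) (X₀ : H) (F : H → H)
    (β : ℝ) (hβ : β ∈ Ioc (0 : ℝ) 1)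
    (hA : SPDE.EquationAssumptions A S X₀ β R F)
    (V : Ioc (0 : ℝ) 1 → Submodule ℝ H) [∀ h, FiniteDimensional ℝ (V h)]
    (Ah : ∀ h, V h →ₗ[ℝ] V h)
    (hV : SPDE.SchemeAssumptions V Ah T A S)
    (X : Ioc (0 : ℝ) 1 → Ioc (0 : ℝ) 1 → ℕ → Ω → H)
    (hX : ∀ h k : Ioc (0 : ℝ) 1, SPDE.IsScheme V Ah T F X₀ R W h k (X h k))
    (p q : ℝ≥0∞) [Fact (1 ≤ q)] (hp : 2 ≤ p) (hp' : p ≠ ∞) (hq : 2 ≤ q)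
    (hq' : β < 1 → q < ENNReal.ofReal (2 / (1 - β))) :
    ∃ C : ℝ≥0, ∀ h k : Ioc (0 : ℝ) 1, ∀ n : ℕ, 1 ≤ n → n ≤ SPDE.numSteps T k →
      SPDE.malliavinNorm T W p q (X h k n) ≤ C := by
  have hγ0 : 0 ≤ (1 - β) / 2 := by linarith [hβ.2]
  have hγ1 : (1 - β) / 2 < 1 / 2 := by linarith [hβ.1]
  have hp1 : 1 ≤ p := le_trans (by norm_num) hp
  have hq0 : q ≠ 0 := fun h => by simp [h] at hq
  obtain ⟨D, hD, L, hL⟩ := hA.drift₁.exists_isGateauxDeriv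
  obtain ⟨C, hC0, hC⟩ := hV.exists_norm_pow_le
  obtain ⟨M, hM0, hM⟩ := hV.exists_hsSq_le hγ0 hγ1.le hA.noise
  obtain ⟨Kq, hKq⟩ := SPDE.exists_eLpNorm_step_le (SPDE.HS (SPDE.CM R) H) (T := T) (q := q) M hM0
    hγ0 hq0 fun h => by
      rw [one_div_div]
      exact hq' (by linarith)
  obtain ⟨Ks, hKs⟩ := SPDE.exists_sum_sq_rpow_neg_le (T := T) hM0 hγ0 hγ1
  have hmom := (SPDE.gaussianMoment_lt_top hp').ne
  let E : ℝ≥0 := (Real.exp (T * (C * L))).toNNReal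
  let a : ℝ≥0 := (((1 + C) * ‖X₀‖ + T * C * ‖F 0‖).toNNReal +
    (SPDE.gaussianMoment p).toNNReal * Ks) * E
  let b : ℝ≥0 := Kq * E
  refine ⟨(a ^ p.toReal + b ^ p.toReal) ^ (1 / p.toReal), fun h k n _ hn => ?_⟩
  have hk : 0 < (k : ℝ) := k.2.1
  have hNk := SPDE.mul_le_of_le_numSteps hT.le hk (le_refl (SPDE.numSteps T k))
  have hS : ∀ m, 1 ≤ m → m ≤ SPDE.numSteps T k → ‖SPDE.schemeOp V Ah h k ^ m‖ ≤ C :=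
    hC h k k.2
  have hΦ : ∀ x, (SPDE.schemeOp V Ah h k ∘L SPDE.CM.incl R) x ∈ V h :=
    fun x => SPDE.schemeOp_mem _
  have hE : ∀ n ≤ SPDE.numSteps T k, (1 + ENNReal.ofReal (k * (C * L))) ^ n ≤ E := by
    intro n hn
    refine SPDE.one_add_ofReal_pow_le (by positivity) ?_
    have := SPDE.mul_le_of_le_numSteps hT.le hk hn
    calc (n : ℝ) * (k * (C * L)) = (n * k) * (C * L) := by ring
      _ ≤ T * (C * L) := by gcongr
  let G := SPDE.schemeMap (SPDE.schemeOpV V Ah h k) F k ((V h).orthogonalProjectionOnto X₀)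
    (SPDE.numSteps T k)
  let Y := SPDE.coordIncrement (V h) W (SPDE.schemeOp V Ah h k ∘L SPDE.CM.incl R) k
    (SPDE.numSteps T k)
  let φ := SPDE.noiseIntegrand (V h) T q k (SPDE.schemeOp V Ah h k ∘L SPDE.CM.incl R)
    (SPDE.numSteps T k)
  have hrep : ∀ n ≤ SPDE.numSteps T k, ∀ᵐ ω ∂P, X h k n ω = G n fun i => Y i ω :=
    fun n hn => (hX h k).ae_eq_schemeMap hW hT.le hk hn
  have hY : ∀ i, SPDE.IsWienerIntegral T W (fun t => innerSL ℝ (φ i t)) (Y i) := fun i =>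
    SPDE.isWienerIntegral_increment W (by positivity) (by push_cast; linarith)
      (SPDE.mul_le_of_le_numSteps hT.le hk (Nat.succ_le_of_lt i.1.2)) _
      (SPDE.stepLp_coeFn T q k i.1 _)
  have hYm : AEStronglyMeasurable (fun ω i => Y i ω) P :=
    (aemeasurable_pi_lambda _ fun i => (hY i).1.aemeasurable).aestronglyMeasurable
  have hXm : ∀ n ≤ SPDE.numSteps T k, AEStronglyMeasurable (X h k n) P := fun n hn =>
    ((continuous_subtype_val.comp (SPDE.contDiff_schemeMap hD n).continuous).comp_aestronglyMeasurable
      hYm).congr (EventuallyEq.symm (hrep n hn))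
  obtain ⟨CG, hCG⟩ := SPDE.exists_norm_fderiv_schemeMap_le (B := SPDE.schemeOpV V Ah h k) (k := k)
    (x₀ := (V h).orthogonalProjectionOnto X₀) (N := SPDE.numSteps T k) hD hL n
  have hGc := SPDE.contDiff_schemeMap (B := SPDE.schemeOpV V Ah h k) (k := k)
    (x₀ := (V h).orthogonalProjectionOnto X₀) (N := SPDE.numSteps T k) hD n
  have hsmooth := SPDE.isSmooth_of_contDiff hGc hCG φ hY (hrep n hn)
  -- the moments of the scheme
  have hXb : eLpNorm (X h k n) p P ≤ a := by
    have hZ : ∀ n ≤ SPDE.numSteps T k, eLpNorm (fun ω => ∑ j ∈ Finset.range n,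
        SPDE.blockIncrement (V h) W ((SPDE.schemeOp V Ah h k ^ (n - 1 - j)) ∘L
          (SPDE.schemeOp V Ah h k ∘L SPDE.CM.incl R)) (j * k) ((j + 1 : ℕ) * k) ω) p P ≤
        SPDE.gaussianMoment p * Ks := by
      intro n hn
      refine (ENNReal.pow_right_strictMono two_ne_zero).le_iff_le.1 ?_
      have hnk := SPDE.mul_le_of_le_numSteps hT.le hk hn
      have hmono : Monotone fun j : ℕ => (j : ℝ) * (k : ℝ) := fun i j hij => by
        dsimp only
        gcongr
      refine (hW.eLpNorm_sum_blockIncrement_sq_le (V := V h) hmono (by simp) (fun j =>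
        (SPDE.schemeOp V Ah h k ^ (n - 1 - j)) ∘L (SPDE.schemeOp V Ah h k ∘L SPDE.CM.incl R))
        n hnk hp).trans ?_
      rw [mul_pow]
      gcongr
      refine le_trans (Finset.sum_le_sum fun j hj => ?_) (hKs k hk n hnk)
      rw [show ((j + 1 : ℕ) : ℝ) * (k : ℝ) - j * k = k by push_cast; ring]
      gcongr
      exact hM h k k.2 n hn j (Finset.mem_range.1 hj)
    have hb := SPDE.eLpNorm_le_of_recursion hA.drift₁.1 L.2 (hD.norm_le hL) hk.le hC0 hS hp1 hXm
      (fun n _ => Finset.aestronglyMeasurable_fun_sum _ fun j _ =>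
        SPDE.aestronglyMeasurable_blockIncrement (V h) W _ _ _) hNk hZ
      (fun n hn => (hX h k).ae_eq_sum hW hT.le hk hn) hn
    refine hb.trans ?_
    have hP : ‖((V h).orthogonalProjectionOnto X₀ : H)‖ ≤ ‖X₀‖ :=
      (V h).norm_orthogonalProjectionOnto_apply_le X₀
    simp only [a, ENNReal.coe_mul, ENNReal.coe_add, ENNReal.coe_toNNReal hmom]
    gcongr
    · change _ ≤ ENNReal.ofReal _
      gcongr
    · exact hE n hn
  -- the derivative is bounded, uniformly in the random parameter `x = ξ(ω)`
  have hDb : ∀ x, ‖SPDE.tangentLp φ (fderiv ℝ (G n) x)‖ₑ ≤ b := by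
    intro x
    refine (SPDE.enorm_tangentLp_schemeMap_le hD hL hk.le hC0 hS (K := Kq) ?_ hn x).trans ?_
    · intro n hn
      rw [SPDE.enorm_sum_stepLp]
      refine hKq k hk n (SPDE.mul_le_of_le_numSteps hT.le hk hn) _ fun j hj => ?_
      have h1 := (SPDE.enorm_blockHS_sq hΦ (SPDE.schemeOp V Ah h k ^ (n - 1 - j))).trans_le
        (hM h k k.2 n hn j hj)
      have h2 := (ENNReal.pow_right_strictMono two_ne_zero).le_iff_le.1 h1
      have h3 : 0 ≤ M * (((n - j : ℕ) : ℝ) * k) ^ (-((1 - β) / 2)) := by positivity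
      rw [← ofReal_norm, ENNReal.ofReal_le_ofReal_iff h3] at h2
      exact h2
    · simp only [b, ENNReal.coe_mul]
      gcongr
      exact hE n hn
  have hDXb : eLpNorm (fun ω => SPDE.tangentLp φ (fderiv ℝ (G n) fun i => Y i ω)) p P ≤ b := by
    refine (eLpNorm_le_of_ae_enorm_bound (Eventually.of_forall fun ω => hDb _)).trans ?_
    simp
  have hDXm : AEStronglyMeasurable
      (fun ω => SPDE.tangentLp φ (fderiv ℝ (G n) fun i => Y i ω)) P :=
    ((SPDE.continuous_tangentLp φ).comp
      (hGc.continuous_fderiv one_ne_zero)).comp_aestronglyMeasurable hYm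
  refine (SPDE.malliavinNorm_le_of_isSmooth hsmooth ⟨hXm n hn, hXb.trans_lt ENNReal.coe_lt_top⟩
    ⟨hDXm, hDXb.trans_lt ENNReal.coe_lt_top⟩ hXb hDXb).trans (le_of_eq ?_)
  rw [ENNReal.coe_rpow_of_nonneg _ (by positivity), ENNReal.coe_add,
    ENNReal.coe_rpow_of_nonneg _ (by positivity), ENNReal.coe_rpow_of_nonneg _ (by positivity)]
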